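/- Let $M$ be a closed (compact, without boundary) connected Hausdorff smooth manifold of dimension $n$. Let $F:TM\to[0,\infty)$ be a Finsler metric, not necessarily reversible: $F$ is $C^\infty$ on $TM\setminus\{0\}$, $F(x,\lambda y)=\lambda F(x,y)$ for all $\lambda>0$, and for every nonzero $y\in T_xM$ the matrix $\big(\tfrac12 (F^2)_{y^iy^j}(x,y)\big)$ is positive definite. Let $\mathfrak m$ be a positive smooth measure on $M$ (in every smooth chart $d\mathfrak m=\sigma\,dx^1\cdots dx^n$ with $\sigma$ smooth and positive) with $\mathfrak m(M)=1$. Let $d_F(x_1,x_2)=\inf_\gamma\int_0^1F(\gamma(t),\dot\gamma(t))\,dt$, the infimum over all $C^1$ curves $\gamma:[0,1]\to M$ with $\gamma(0)=x_1$ and $\gamma(1)=x_2$. For $A\subset M$ and $r>0$ put $B^+(A,r)=\{x:\inf_{z\in A}d_F(z,x)<r\}$ and $B^-(A,r)=\{x:\inf_{z\in A}d_F(x,z)<r\}$, and define the concentration function $$\alpha(r)=\sup\Big\{1-\min\{\mathfrak m(B^+(A,r)),\mathfrak m(B^-(A,r))\}\;:\;A\subset M\text{ Borel},\ \mathfrak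 m(A)\ge\tfrac12\Big\},\qquad r>0.$$ Let $F^*(x,\xi)=\sup_{y\in T_xM\setminus\{0\}}\xi(y)/F(x,y)$ for $\xi\in T_x^*M$, and define the first closed eigenvalue $$\lambda_1(M)=\inf_{u}\frac{\int_M F^*(du)^2\,d\mathfrak m}{\inf_{c\in\mathbb R}\int_M|u-c|^2\,d\mathfrak m},$$ the infimum over all non-constant $u\in C^\infty(M)$ (read as $0$ in the trivial case that $M$ is a point). Then for every $r>0$ $$\alpha(r)\le\exp\!\Big(-r\sqrt{\lambda_1(M)}\,\frac{\log 2}{\sqrt2}\Big),$$ and $(M,F,\mathfrak m)$ has exponential concentration: there are constants $C,c>0$ such that $\alpha(r)\le C e^{-cr}$ for every $r>0$. -/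

import Mathlib

open MeasureTheory Set
open scoped Manifold ContDiff

noncomputable section

/-! ### Irreversible metric measure spaces -/

/-- The forward open `r`-neighbourhood `B⁺(A, r) = {x | inf_{z ∈ A} d(z, x) < r}` of `A`. -/
def forwardNhd {X : Type*} (d : X → X → ℝ) (A : Set X) (r : ℝ) : Set X :=
  {x | ∃ z ∈ A, d z x < r}

/-- The backward open `r`-neighbourhood `B⁻(A, r) = {x | inf_{z ∈ A} d(x, z) < r}` of `A`. -/
def backwardNhd {X : Type*} (d : X → X → ℝ) (A : Set X) (r : ℝ) : Set X :=
  {x | ∃ z ∈ A, d x z < r}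

/-- The concentration function: the supremum of `1 - min {μ(B⁺(A, r)), μ(B⁻(A, r))}` over all
measurable `A` with `μ(A) ≥ 1/2`. -/
def concentrationFunction {X : Type*} [MeasurableSpace X] (d : X → X → ℝ) (μ : Measure X)
    (r : ℝ) : ℝ :=
  sSup {a : ℝ | ∃ A : Set X, MeasurableSet A ∧ 1 / 2 ≤ μ.real A ∧
    a = 1 - min (μ.real (forwardNhd d A r)) (μ.real (backwardNhd d A r))}

/-- Exponential concentration: `α(r) ≤ C exp(-c r)` for all `r > 0`, with positive constants. -/
def HasExponentialConcentration {X : Type*} [MeasurableSpace X] (d : X → X → ℝ)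
    (μ : Measure X) : Prop :=
  ∃ C c : ℝ, 0 < C ∧ 0 < c ∧
    ∀ r : ℝ, 0 < r → concentrationFunction d μ r ≤ C * Real.exp (-(c * r))

/-! ### Finsler manifolds -/

/-- The value `g_y(v, w) = ∂²/∂s∂t [F²(y + s v + t w) / 2]` at `s = t = 0` of the fundamental
tensor of a function `F` on a real vector space. -/
def fundamentalTensor {V : Type*} [AddCommGroup V] [Module ℝ V] (F : V → ℝ) (y v w : V) : ℝ :=
  deriv (fun s : ℝ => deriv (fun t : ℝ => F (y + s • v + t • w) ^ 2 / 2) 0) 0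

/-- A (not necessarily reversible) Finsler metric on the smooth `n`-manifold `M`. -/
structure FinslerMetric (n : ℕ) (M : Type*) [TopologicalSpace M]
    [ChartedSpace (EuclideanSpace ℝ (Fin n)) M] [IsManifold (𝓡 n) ∞ M] where
  /-- the function `F(x, y)`, for `y ∈ T_x M` -/
  toFun : (x : M) → TangentSpace (𝓡 n) x → ℝ
  nonneg : ∀ (x : M) (y : TangentSpace (𝓡 n) x), 0 ≤ toFun x y
  /-- regularity: `F` is smooth on the slit tangent bundle -/
  smooth : ContMDiffOn (𝓡 n).tangent 𝓘(ℝ, ℝ) ∞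
    (fun p : TangentBundle (𝓡 n) M => toFun p.proj p.snd) {p | p.snd ≠ 0}
  /-- positive 1-homogeneity -/
  homogeneous : ∀ (x : M) (y : TangentSpace (𝓡 n) x) (c : ℝ), 0 < c →
    toFun x (c • y) = c * toFun x y
  /-- strong convexity -/
  strongly_convex : ∀ (x : M) (y : TangentSpace (𝓡 n) x), y ≠ 0 →
    ∀ w : TangentSpace (𝓡 n) x, w ≠ 0 → 0 < fundamentalTensor (toFun x) y w w

namespace FinslerMetric

/-- The length `∫₀¹ F(γ, γ') dt` of a curve. -/
def length {n : ℕ} {M : Type*} [TopologicalSpace M]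
    [ChartedSpace (EuclideanSpace ℝ (Fin n)) M] [IsManifold (𝓡 n) ∞ M]
    (F : FinslerMetric n M) (γ : ℝ → M) : ℝ :=
  ∫ t in Icc (0 : ℝ) 1,
    F.toFun (γ t) (mfderivWithin 𝓘(ℝ, ℝ) (𝓡 n) γ (Icc (0 : ℝ) 1) t (1 : ℝ))

/-- The (asymmetric) distance from `x₁` to `x₂`: the infimum of the lengths of the `C¹` curves
`γ : [0, 1] → M` from `x₁` to `x₂`. -/
def dist {n : ℕ} {M : Type*} [TopologicalSpace M]
    [ChartedSpace (EuclideanSpace ℝ (Fin n)) M] [IsManifold (𝓡 n) ∞ M]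
    (F : FinslerMetric n M) (x₁ x₂ : M) : ℝ :=
  sInf {ℓ : ℝ | ∃ γ : ℝ → M, ContMDiffOn 𝓘(ℝ, ℝ) (𝓡 n) 1 γ (Icc (0 : ℝ) 1) ∧
    γ 0 = x₁ ∧ γ 1 = x₂ ∧ ℓ = F.length γ}

/-- The dual metric `F*(x, ξ) = sup_{y ≠ 0} ξ(y) / F(x, y)`. -/
def dual {n : ℕ} {M : Type*} [TopologicalSpace M]
    [ChartedSpace (EuclideanSpace ℝ (Fin n)) M] [IsManifold (𝓡 n) ∞ M]
    (F : FinslerMetric n M) (x : M) (ξ : TangentSpace (𝓡 n) x →L[ℝ] ℝ) : ℝ :=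
  sSup {a : ℝ | ∃ y : TangentSpace (𝓡 n) x, y ≠ 0 ∧ a = ξ y / F.toFun x y}

/-- The energy `∫ F*(du)² dm`. -/
def energy {n : ℕ} {M : Type*} [TopologicalSpace M]
    [ChartedSpace (EuclideanSpace ℝ (Fin n)) M] [IsManifold (𝓡 n) ∞ M] [MeasurableSpace M]
    (F : FinslerMetric n M) (m : Measure M) (u : M → ℝ) : ℝ :=
  ∫ x, F.dual x (mfderiv (𝓡 n) 𝓘(ℝ, ℝ) u x) ^ 2 ∂m

/-- The first closed eigenvalue: the infimum over smooth `u` of the quotient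
`∫ F*(du)² dm / inf_c ∫ |u - c|² dm`, where it is defined (that is, where `u` is not constant). -/
def firstEigenvalue {n : ℕ} {M : Type*} [TopologicalSpace M]
    [ChartedSpace (EuclideanSpace ℝ (Fin n)) M] [IsManifold (𝓡 n) ∞ M] [MeasurableSpace M]
    (F : FinslerMetric n M) (m : Measure M) : ℝ :=
  sInf {q : ℝ | ∃ u : M → ℝ, ContMDiff (𝓡 n) 𝓘(ℝ, ℝ) ∞ u ∧
    (⨅ c : ℝ, ∫ x, |u x - c| ^ 2 ∂m) ≠ 0 ∧
    q = F.energy m u / ⨅ c : ℝ, ∫ x, |u x - c| ^ 2 ∂m}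

end FinslerMetric

/-- A positive smooth measure: in every smooth chart it is `σ(x) dx¹ ⋯ dxⁿ` with `σ` smooth and
positive. -/
def IsPositiveSmoothMeasure (n : ℕ) {M : Type*} [TopologicalSpace M]
    [ChartedSpace (EuclideanSpace ℝ (Fin n)) M] [MeasurableSpace M] (m : Measure M) : Prop :=
  ∀ e ∈ IsManifold.maximalAtlas (𝓡 n) ∞ M, ∃ σ : EuclideanSpace ℝ (Fin n) → ℝ,
    ContDiffOn ℝ ∞ σ e.target ∧ (∀ x ∈ e.target, 0 < σ x) ∧
    ∀ S : Set M, MeasurableSet S → S ⊆ e.source →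
      m S = ∫⁻ x in e '' S, ENNReal.ofReal (σ x)

end

/-! The bound comes from a spectral inequality for separated sets. Let `A`, `B` have measures `a`,
`b` and satisfy `d(x, z) ≥ ε` for `x ∈ A`, `z ∈ B`. Test the Rayleigh quotient on the forward
distance `f = d(A, ·)`, cut off at heights `0` and `ε`. The function is `0` on `A` and `ε` on `B`,
so its variance is at least `ε² ab / (a + b)`. Its differential has dual norm at most `1` and
vanishes on `A ∪ B`, so its energy is at most `1 - a - b`. Hence `λ₁ ε² ab ≤ (a + b)(1 - a - b)`,
which is `firstEigenvalue_mul_measure_le`.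

Take `λ₁ ε² = 2`, `a ≥ 1/2` and `B` the complement of the `ε`-neighbourhood of `A`: the inequality
forces `b ≤ (1 - a)/2`. Each enlargement by `ε` thus halves the complement. Iterating from a
complement of measure at most `1/2` gives decay `2^(-r/ε)` with `ε = √(2/λ₁)`, which is the stated
rate. The separated-set inequality is symmetric in the two measures, so exchanging the sets handles
backward neighbourhoods without reversing the metric.

The analytic difficulty is that `f` is only Lipschitz while `λ₁` tests smooth functions.
`exists_contMDiff_approx` smooths `f`, keeping the one-sided bound `dh(y) ≤ (1 + δ) F(y)`: in a
small chart `F` is nearly a fixed positively homogeneous function `b`, mollification preserves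
`b`-bounded increments, and a partition of unity glues the pieces.

Exponential concentration with unspecified constants needs no spectral information, only a bounded
distance. -/

open Filter Topology

/-! ### Positivity, continuity and local comparison of the metric -/

namespace FinslerMetric

variable {n : ℕ} {M : Type*} [TopologicalSpace M] [ChartedSpace (EuclideanSpace ℝ (Fin n)) M]
  [IsManifold (𝓡 n) ∞ M] (F : FinslerMetric n M)

theorem apply_zero (x : M) : F.toFun x 0 = 0 := by
  have h := F.homogeneous x 0 2 two_pos
  rw [smul_zero] at h
  linarith

theorem homogeneous_of_nonneg (x : M) (y : TangentSpace (𝓡 n) x) {c : ℝ} (hc : 0 ≤ c) :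
    F.toFun x (c • y) = c * F.toFun x y := by
  rcases hc.eq_or_lt with rfl | hc
  · rw [zero_smul, zero_mul, F.apply_zero]
  · exact F.homogeneous x y c hc

/-- Strong convexity forces `F` to be positive on nonzero vectors. -/
theorem pos {x : M} {y : TangentSpace (𝓡 n) x} (hy : y ≠ 0) : 0 < F.toFun x y := by
  refine (F.nonneg x y).lt_of_ne' fun h0 => ?_
  have h := F.strongly_convex x y hy y hy
  -- If `F` vanished at `y` it would vanish on the whole open ray through `y`, and then `g_y(y, y) =
  -- 0`.
  have key : ∀ s t : ℝ, 0 < 1 + s + t → F.toFun x (y + s • y + t • y) ^ 2 / 2 = 0 := by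
    intro s t hst
    have : y + s • y + t • y = (1 + s + t) • y := by simp only [add_smul, one_smul]
    rw [this, F.homogeneous x y _ hst, h0]
    norm_num
  have hs : ∀ᶠ s : ℝ in 𝓝 0,
      deriv (fun t : ℝ => F.toFun x (y + s • y + t • y) ^ 2 / 2) 0 = 0 := by
    filter_upwards [lt_mem_nhds (show (-1 : ℝ) < 0 by norm_num)] with s hs
    have : (fun t : ℝ => F.toFun x (y + s • y + t • y) ^ 2 / 2) =ᶠ[𝓝 0] fun _ => 0 := by
      filter_upwards [lt_mem_nhds (show -(1 + s) < 0 by linarith)] with t ht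
      exact key s t (by linarith)
    rw [this.deriv_eq, deriv_const]
  have h2 : fundamentalTensor (F.toFun x) y y y = 0 := by
    unfold fundamentalTensor
    have := Filter.EventuallyEq.deriv_eq (f := fun _ : ℝ => (0 : ℝ)) hs
    rw [this, deriv_const]
  exact h.ne' h2

/-- The metric read in the trivialization of the tangent bundle centred at `p`. -/
noncomputable def localForm (p x : M) (v : EuclideanSpace ℝ (Fin n)) : ℝ :=
  F.toFun x ((trivializationAt (EuclideanSpace ℝ (Fin n)) (TangentSpace (𝓡 n)) p).symmL ℝ x v)

theorem localForm_smul (p x : M) (v : EuclideanSpace ℝ (Fin n)) {c : ℝ} (hc : 0 ≤ c) :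
    F.localForm p x (c • v) = c * F.localForm p x v := by
  unfold localForm
  rw [map_smul, F.homogeneous_of_nonneg x _ hc]

theorem localForm_pos {p x : M} (hx : x ∈ (chartAt (EuclideanSpace ℝ (Fin n)) p).source)
    {v : EuclideanSpace ℝ (Fin n)} (hv : v ≠ 0) : 0 < F.localForm p x v := by
  refine F.pos fun h => hv ?_
  have := (trivializationAt (EuclideanSpace ℝ (Fin n))
    (TangentSpace (𝓡 n)) p).continuousLinearMapAt_symmL (R := ℝ) (b := x) (by simpa using hx) v
  rw [h, map_zero] at this
  exact this.symm

/-- The trivialization centred at `p` is the differential of the chart at `p`, so `localForm` is `F`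
in chart coordinates. -/
theorem localForm_mfderiv {p x : M} (hx : x ∈ (chartAt (EuclideanSpace ℝ (Fin n)) p).source)
    (y : TangentSpace (𝓡 n) x) :
    F.localForm p x (mfderiv (𝓡 n) 𝓘(ℝ, EuclideanSpace ℝ (Fin n)) (extChartAt (𝓡 n) p) x y) =
      F.toFun x y := by
  unfold localForm
  rw [← TangentBundle.continuousLinearMapAt_trivializationAt hx]
  congr 1
  exact (trivializationAt (EuclideanSpace ℝ (Fin n))
    (TangentSpace (𝓡 n)) p).symmL_continuousLinearMapAt (R := ℝ) (b := x) (by simpa using hx) y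

/-- The zero vector is excluded because `F` is only assumed smooth on the slit bundle. -/
theorem continuousOn_localForm (p : M) :
    ContinuousOn (fun z : M × EuclideanSpace ℝ (Fin n) => F.localForm p z.1 z.2)
      ((chartAt (EuclideanSpace ℝ (Fin n)) p).source ×ˢ {0}ᶜ) := by
  set T := trivializationAt (EuclideanSpace ℝ (Fin n)) (TangentSpace (𝓡 n)) p with hT
  have hb : T.baseSet = (chartAt (EuclideanSpace ℝ (Fin n)) p).source := by simp [hT]
  have h1 := F.smooth.continuousOn
  have h2 : ContinuousOn T.toOpenPartialHomeomorph.symm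
      ((chartAt (EuclideanSpace ℝ (Fin n)) p).source ×ˢ {0}ᶜ) := by
    refine T.toOpenPartialHomeomorph.continuousOn_symm.mono ?_
    rintro ⟨x, v⟩ ⟨hx, -⟩
    have : x ∈ T.baseSet := hb ▸ hx
    simpa [T.target_eq] using this
  have h3 : ∀ z ∈ (chartAt (EuclideanSpace ℝ (Fin n)) p).source ×ˢ
      ({0}ᶜ : Set (EuclideanSpace ℝ (Fin n))), T.toOpenPartialHomeomorph.symm z =
      ⟨z.1, T.symmL ℝ z.1 z.2⟩ := by
    rintro ⟨x, v⟩ ⟨hx, -⟩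
    rw [T.symmL_apply (R := ℝ) (show x ∈ T.baseSet from hb ▸ hx) v]
    exact (T.mk_symm (show x ∈ T.baseSet from hb ▸ hx) v).symm
  refine (h1.comp h2 ?_).congr ?_
  · intro z hz
    rw [h3 z hz]
    intro h
    exact (F.localForm_pos hz.1 hz.2).ne' (by
      unfold localForm
      exact (congrArg (F.toFun z.1) h).trans (F.apply_zero _))
  · intro z hz
    simp only [Function.comp_apply]
    rw [h3 z hz]
    rfl

/-- Near `p`, the metric read in the chart at `p` is multiplicatively close to a fixed positively
homogeneous function. -/
theorem exists_local_bound (p : M) {η : ℝ} (hη : 0 < η) :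
    ∃ b : EuclideanSpace ℝ (Fin n) → ℝ,
      (∀ (c : ℝ) (v), 0 ≤ c → b (c • v) = c * b v) ∧
      (∃ c > 0, ∀ v, c * ‖v‖ ≤ b v) ∧ (∃ C > 0, ∀ v, b v ≤ C * ‖v‖) ∧
      ∀ᶠ x in 𝓝 p, ∀ y : TangentSpace (𝓡 n) x,
        F.toFun x y ≤
          b (mfderiv (𝓡 n) 𝓘(ℝ, EuclideanSpace ℝ (Fin n)) (extChartAt (𝓡 n) p) x y) ∧
        b (mfderiv (𝓡 n) 𝓘(ℝ, EuclideanSpace ℝ (Fin n)) (extChartAt (𝓡 n) p) x y) ≤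
          (1 + η) * F.toFun x y := by
  -- The bound is `b = k · F_p`, with `F_p` the metric at `p` in coordinates. Comparing `F_x` and
  -- `F_p` up to a factor `k` both ways gives `F_x ≤ k F_p ≤ k² F_x`, whence `k² = 1 + η`.
  set k : ℝ := √(1 + η) with hk
  have hk2 : k * k = 1 + η := Real.mul_self_sqrt (by linarith)
  have hk1 : 1 < k := by rw [hk, Real.lt_sqrt] <;> linarith
  have hsrc : (chartAt (EuclideanSpace ℝ (Fin n)) p).source ∈ 𝓝 p := chart_source_mem_nhds _ p
  have hpos : ∀ v : EuclideanSpace ℝ (Fin n), v ≠ 0 → 0 < F.localForm p p v :=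
    fun v hv => F.localForm_pos (mem_chart_source _ p) hv
  have hcont : ∀ v : EuclideanSpace ℝ (Fin n), v ≠ 0 →
      ContinuousAt (fun z : M × EuclideanSpace ℝ (Fin n) => F.localForm p z.1 z.2) (p, v) :=
    fun v hv => (F.continuousOn_localForm p).continuousAt
      (prod_mem_nhds hsrc (isOpen_compl_singleton.mem_nhds hv))
  have hcont1 : ContinuousOn (F.localForm p p) {0}ᶜ := fun v hv =>
    ((hcont v hv).comp (f := fun w => (p, w))
      (Continuous.prodMk_right p).continuousAt).continuousWithinAt
  have hS : IsCompact (Metric.sphere (0 : EuclideanSpace ℝ (Fin n)) 1) := isCompact_sphere 0 1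
  have hS0 : ∀ v ∈ Metric.sphere (0 : EuclideanSpace ℝ (Fin n)) 1, v ≠ 0 := by
    rintro v hv rfl
    simp at hv
  have hext : ∀ v : EuclideanSpace ℝ (Fin n), v ≠ 0 →
      ∃ w ∈ Metric.sphere (0 : EuclideanSpace ℝ (Fin n)) 1, v = ‖v‖ • w := by
    intro v hv
    have hv' : ‖v‖ ≠ 0 := norm_ne_zero_iff.2 hv
    refine ⟨‖v‖⁻¹ • v, ?_, ?_⟩
    · simp [norm_smul, hv']
    · rw [smul_smul, mul_inv_cancel₀ hv', one_smul]
  have hzero : ∀ x, F.localForm p x 0 = 0 := fun x => by simp [localForm, F.apply_zero]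
  obtain ⟨c, hc0, hc⟩ := hS.exists_forall_le' (hcont1.mono fun v hv => hS0 v hv)
    (a := 0) fun v hv => hpos v (hS0 v hv)
  obtain ⟨C, hC⟩ := hS.exists_bound_of_continuousOn (hcont1.mono fun v hv => hS0 v hv)
  have hev : ∀ᶠ x in 𝓝 p, ∀ v ∈ Metric.sphere (0 : EuclideanSpace ℝ (Fin n)) 1,
      F.localForm p x v < k * F.localForm p p v ∧
        F.localForm p p v < k * F.localForm p x v := by
    -- Compactness of the unit sphere makes the neighbourhood of `p` uniform in `v`; homogeneity
    -- then extends the comparison to all vectors.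
    refine hS.eventually_forall_of_forall_eventually fun v hv => ?_
    have hcv := hcont v (hS0 v hv)
    have hpv := hpos v (hS0 v hv)
    have hcv' : ContinuousAt (fun z : M × EuclideanSpace ℝ (Fin n) => F.localForm p p z.2) (p, v) :=
      ContinuousAt.comp (x := ((p, v) : M × EuclideanSpace ℝ (Fin n)))
        (f := fun z : M × EuclideanSpace ℝ (Fin n) => (p, z.2))
        (g := fun z : M × EuclideanSpace ℝ (Fin n) => F.localForm p z.1 z.2)
        (hcont v (hS0 v hv)) (by fun_prop)
    refine (hcv.eventually_lt (continuousAt_const.mul hcv') ?_).and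
      (hcv'.eventually_lt (continuousAt_const.mul hcv) ?_) <;>
    · show F.localForm p p v < k * F.localForm p p v
      nlinarith
  refine ⟨fun v => k * F.localForm p p v, fun a v ha => ?_, ⟨c, hc0, fun v => ?_⟩,
    ⟨k * (|C| + 1), by positivity, fun v => ?_⟩, ?_⟩
  · simp only [F.localForm_smul p p v ha]; ring
  · rcases eq_or_ne v 0 with rfl | hv
    · simp [hzero]
    · obtain ⟨w, hw, hvw⟩ := hext v hv
      beta_reduce
      rw [hvw, F.localForm_smul p p w (norm_nonneg v), ← hvw]
      have h1 := hc w hw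
      have h2 : c ≤ k * F.localForm p p w := by nlinarith
      nlinarith [mul_le_mul_of_nonneg_left h2 (norm_nonneg v)]
  · rcases eq_or_ne v 0 with rfl | hv
    · simp [hzero]
    · obtain ⟨w, hw, hvw⟩ := hext v hv
      beta_reduce
      rw [hvw, F.localForm_smul p p w (norm_nonneg v), ← hvw, mul_assoc k]
      have h1 : F.localForm p p w ≤ |C| + 1 := by
        linarith [le_abs_self (F.localForm p p w), hC w hw, Real.norm_eq_abs (F.localForm p p w),
          le_abs_self C]
      have := mul_le_mul_of_nonneg_left h1 (norm_nonneg v)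
      exact mul_le_mul_of_nonneg_left (by linarith) (by linarith)
  · filter_upwards [hev, hsrc] with x hx hxs y
    obtain ⟨v, hv⟩ : ∃ v : EuclideanSpace ℝ (Fin n), v =
      mfderiv (𝓡 n) 𝓘(ℝ, EuclideanSpace ℝ (Fin n)) (extChartAt (𝓡 n) p) x y := ⟨_, rfl⟩
    rw [← F.localForm_mfderiv hxs y, ← hk2]
    erw [← hv]
    rcases eq_or_ne v 0 with h0 | h0
    · rw [h0]; simp [hzero]
    · obtain ⟨w, hw, hvw⟩ := hext v h0
      obtain ⟨h1, h2⟩ := hx w hw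
      rw [hvw, F.localForm_smul p p w (norm_nonneg v), F.localForm_smul p x w (norm_nonneg v)]
      have h3 := mul_le_mul_of_nonneg_left h1.le (norm_nonneg v)
      have h4 := mul_le_mul_of_nonneg_left h2.le (norm_nonneg v)
      constructor
      · linarith
      · have := mul_le_mul_of_nonneg_left h4 (show 0 ≤ k by linarith)
        linarith

/-- The metric is continuous on the whole tangent bundle, zero section included. -/
theorem continuous_toFun :
    Continuous fun q : TangentBundle (𝓡 n) M => F.toFun q.proj q.snd := by
  refine continuous_iff_continuousAt.2 fun q => ?_
  obtain ⟨p, y⟩ := q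
  set T := trivializationAt (EuclideanSpace ℝ (Fin n)) (TangentSpace (𝓡 n)) p with hT
  have hb : T.baseSet = (chartAt (EuclideanSpace ℝ (Fin n)) p).source := by simp [hT]
  have hpr : ContinuousAt (fun q : TangentBundle (𝓡 n) M => q.proj) ⟨p, y⟩ :=
    (FiberBundle.continuous_proj _ _).continuousAt
  have hsrc : ∀ᶠ q : TangentBundle (𝓡 n) M in 𝓝 ⟨p, y⟩,
      q.proj ∈ (chartAt (EuclideanSpace ℝ (Fin n)) p).source :=
    hpr.eventually (chart_source_mem_nhds _ p)
  have hTc : ContinuousAt T (⟨p, y⟩ : TangentBundle (𝓡 n) M) :=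
    T.toOpenPartialHomeomorph.continuousAt (by
      rw [T.source_eq]
      show p ∈ T.baseSet
      rw [hb]
      exact mem_chart_source _ p)
  have hTeq : ∀ q : TangentBundle (𝓡 n) M,
      q.proj ∈ (chartAt (EuclideanSpace ℝ (Fin n)) p).source →
      T q = (q.proj, mfderiv (𝓡 n) 𝓘(ℝ, EuclideanSpace ℝ (Fin n)) (extChartAt (𝓡 n) p)
        q.proj q.snd) := by
    intro q hq
    have h1 := T.apply_eq_prod_continuousLinearEquivAt ℝ q.proj (hb ▸ hq) q.snd
    rw [← TangentBundle.continuousLinearMapAt_trivializationAt hq]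
    refine h1.trans ?_
    congr 1
    exact T.coe_continuousLinearEquivAt_eq (R := ℝ) (hb ▸ hq) ▸ rfl
  -- At a zero vector, `F` is squeezed between `0` and `C‖v‖`; elsewhere continuity comes from the
  -- slit bundle.
  by_cases hy : y = 0
  · subst hy
    obtain ⟨b, -, -, ⟨C, hC0, hC⟩, hbd⟩ := F.exists_local_bound p one_pos
    unfold ContinuousAt
    simp only [F.apply_zero]
    refine squeeze_zero' (g := fun q : TangentBundle (𝓡 n) M => C * ‖(T q).2‖)
      (Eventually.of_forall fun q => F.nonneg _ _) ?_ ?_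
    · filter_upwards [hpr.eventually hbd, hsrc] with q hq hqs
      rw [hTeq q hqs]
      exact (hq q.snd).1.trans (hC _)
    · have h1 : ContinuousAt (fun q : TangentBundle (𝓡 n) M => C * ‖(T q).2‖) ⟨p, 0⟩ :=
        continuousAt_const.mul hTc.snd.norm
      have h2 : (T (⟨p, 0⟩ : TangentBundle (𝓡 n) M)).2 = 0 := by
        rw [hTeq _ (mem_chart_source _ p)]
        exact map_zero _
      have h3 := h1.tendsto
      rw [h2] at h3
      simpa using h3
  · have h0 : (T (⟨p, y⟩ : TangentBundle (𝓡 n) M)).2 ≠ 0 := by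
      intro h
      rw [hTeq _ (mem_chart_source _ p)] at h
      have h2 := F.localForm_mfderiv (mem_chart_source _ p) y
      refine (F.pos hy).ne' (h2.symm.trans ?_)
      refine (congrArg (F.localForm p p) h).trans ?_
      simp [localForm, F.apply_zero]
    have h1 : ContinuousAt (fun q : TangentBundle (𝓡 n) M =>
        (fun z : M × EuclideanSpace ℝ (Fin n) => F.localForm p z.1 z.2) (T q)) ⟨p, y⟩ := by
      refine ContinuousAt.comp ((F.continuousOn_localForm p).continuousAt ?_) hTc
      refine (((chartAt _ p).open_source).prod isOpen_compl_singleton).mem_nhds ⟨?_, h0⟩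
      rw [hTeq _ (mem_chart_source _ p)]
      exact mem_chart_source _ p
    refine h1.congr ?_
    filter_upwards [hsrc] with q hq
    rw [hTeq q hq]
    exact F.localForm_mfderiv hq q.snd

end FinslerMetric

/-! ### Curves, their lengths and the asymmetric distance -/

namespace FinslerMetric

variable {n : ℕ} {M : Type*} [TopologicalSpace M] [ChartedSpace (EuclideanSpace ℝ (Fin n)) M]
  [IsManifold (𝓡 n) ∞ M] (F : FinslerMetric n M)

/-- `ℓ` is the length of some `C¹` curve from `x` to `z`. -/
def IsCurveLength (x z : M) (ℓ : ℝ) : Prop :=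
  ∃ γ : ℝ → M, ContMDiffOn 𝓘(ℝ, ℝ) (𝓡 n) 1 γ (Icc (0 : ℝ) 1) ∧ γ 0 = x ∧ γ 1 = z ∧ ℓ = F.length γ

/-- The speed, at time `t`, of a curve defined on the whole line. -/
noncomputable def speed (γ : ℝ → M) (t : ℝ) : ℝ :=
  F.toFun (γ t) (mfderiv 𝓘(ℝ, ℝ) (𝓡 n) γ t (1 : ℝ))

theorem toFun_congr {x x' : M} (h : x = x') (y : EuclideanSpace ℝ (Fin n)) :
    F.toFun x y = F.toFun x' y := by rw [h]

theorem continuous_unit_section :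
    Continuous fun t : ℝ => (⟨t, (1 : ℝ)⟩ : TangentBundle 𝓘(ℝ, ℝ) ℝ) :=
  (tangentBundleModelSpaceHomeomorph 𝓘(ℝ, ℝ)).symm.continuous.comp
    (Continuous.prodMk_left (1 : ℝ))

theorem continuousOn_speedWithin {γ : ℝ → M}
    (hγ : ContMDiffOn 𝓘(ℝ, ℝ) (𝓡 n) 1 γ (Icc (0 : ℝ) 1)) :
    ContinuousOn (fun t : ℝ =>
      F.toFun (γ t) (mfderivWithin 𝓘(ℝ, ℝ) (𝓡 n) γ (Icc (0 : ℝ) 1) t (1 : ℝ))) (Icc 0 1) := by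
  have h1 := hγ.continuousOn_tangentMapWithin le_rfl
    (uniqueDiffOn_Icc (zero_lt_one' ℝ)).uniqueMDiffOn
  exact F.continuous_toFun.comp_continuousOn
    (h1.comp continuous_unit_section.continuousOn fun t ht => ht)

theorem continuous_speed {γ : ℝ → M} (hγ : ContMDiff 𝓘(ℝ, ℝ) (𝓡 n) 1 γ) :
    Continuous (F.speed γ) :=
  F.continuous_toFun.comp ((hγ.continuous_tangentMap le_rfl).comp continuous_unit_section)

theorem length_nonneg (γ : ℝ → M) : 0 ≤ F.length γ :=
  integral_nonneg fun _ => F.nonneg _ _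

/-- The endpoints are null, and in the interior the derivative within `[0, 1]` is the ordinary one.
-/
theorem length_eq_intervalIntegral (γ : ℝ → M) :
    F.length γ = ∫ t in (0 : ℝ)..1, F.speed γ t := by
  unfold length
  rw [intervalIntegral.integral_of_le zero_le_one, integral_Icc_eq_integral_Ioo,
    integral_Ioc_eq_integral_Ioo]
  refine setIntegral_congr_fun measurableSet_Ioo fun t ht => ?_
  simp only [speed]
  rw [mfderivWithin_of_mem_nhds (Icc_mem_nhds ht.1 ht.2)]

theorem speed_congr {γ γ' : ℝ → M} {t : ℝ} (h : γ =ᶠ[𝓝 t] γ') : F.speed γ t = F.speed γ' t := by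
  unfold speed
  rw [h.mfderiv_eq]
  exact F.toFun_congr h.eq_of_nhds _

/-- Monotonicity is essential: `F` is only positively homogeneous, so the factor `ψ'` comes out only
when it is nonnegative. -/
theorem speed_comp {γ : ℝ → M} (hγ : ContMDiffOn 𝓘(ℝ, ℝ) (𝓡 n) 1 γ (Icc (0 : ℝ) 1))
    {ψ : ℝ → ℝ} (hψ : Differentiable ℝ ψ) (hmono : Monotone ψ)
    (hmem : ∀ t, ψ t ∈ Icc (0 : ℝ) 1) (t : ℝ) :
    F.speed (γ ∘ ψ) t = F.toFun (γ (ψ t))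
      (mfderivWithin 𝓘(ℝ, ℝ) (𝓡 n) γ (Icc (0 : ℝ) 1) (ψ t) (1 : ℝ)) * deriv ψ t := by
  have h1 : HasMFDerivWithinAt 𝓘(ℝ, ℝ) (𝓡 n) (γ ∘ ψ) univ t _ :=
    HasMFDerivWithinAt.comp t
      ((hγ.mdifferentiableOn one_ne_zero) (ψ t) (hmem t)).hasMFDerivWithinAt
      ((hψ t).hasFDerivAt.hasMFDerivAt.hasMFDerivWithinAt) (fun t _ => hmem t)
  rw [hasMFDerivWithinAt_univ] at h1
  unfold speed
  rw [h1.mfderiv, mul_comm, ← F.homogeneous_of_nonneg _ _ hmono.deriv_nonneg]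
  congr 1
  show mfderivWithin 𝓘(ℝ, ℝ) (𝓡 n) γ (Icc (0 : ℝ) 1) (ψ t) (fderiv ℝ ψ t 1) = _
  have h2 : fderiv ℝ ψ t 1 = deriv ψ t • (1 : ℝ) := by simp
  rw [h2]
  exact map_smul (mfderivWithin 𝓘(ℝ, ℝ) (𝓡 n) γ (Icc (0 : ℝ) 1) (ψ t)) (deriv ψ t) (1 : ℝ)

/-- The length of a curve is not changed by a monotone reparametrization. -/
theorem integral_speed_comp {γ : ℝ → M} (hγ : ContMDiffOn 𝓘(ℝ, ℝ) (𝓡 n) 1 γ (Icc (0 : ℝ) 1))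
    {ψ : ℝ → ℝ} (hψ : ContDiff ℝ 1 ψ) (hmono : Monotone ψ)
    (hmem : ∀ t, ψ t ∈ Icc (0 : ℝ) 1) {a b : ℝ} (ha : ψ a = 0) (hb : ψ b = 1) :
    ∫ t in a..b, F.speed (γ ∘ ψ) t = F.length γ := by
  have hd : Differentiable ℝ ψ := hψ.differentiable one_ne_zero
  simp only [F.speed_comp hγ hd hmono hmem]
  have := intervalIntegral.integral_comp_mul_deriv' (a := a) (b := b) (f := ψ) (f' := deriv ψ)
    (g := fun t : ℝ =>
      F.toFun (γ t) (mfderivWithin 𝓘(ℝ, ℝ) (𝓡 n) γ (Icc (0 : ℝ) 1) t (1 : ℝ)))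
    (fun t _ => (hd t).hasDerivAt) (hψ.continuous_deriv le_rfl).continuousOn
    ((F.continuousOn_speedWithin hγ).mono (by rintro _ ⟨t, -, rfl⟩; exact hmem t))
  simp only [Function.comp_apply] at this
  rw [this, ha, hb, intervalIntegral.integral_of_le zero_le_one, ← integral_Icc_eq_integral_Ioc]
  rfl

variable {F}

theorem IsCurveLength.nonneg {x z : M} {ℓ : ℝ} (h : F.IsCurveLength x z ℓ) : 0 ≤ ℓ := by
  obtain ⟨γ, -, -, -, rfl⟩ := h
  exact F.length_nonneg γ

/-- Concatenation of `C¹` curves, after slowing them down at the ends. -/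
theorem IsCurveLength.trans {x y z : M} {a b : ℝ} (h₁ : F.IsCurveLength x y a)
    (h₂ : F.IsCurveLength y z b) : F.IsCurveLength x z (a + b) := by
  obtain ⟨γ₁, hγ₁, rfl, rfl, rfl⟩ := h₁
  obtain ⟨γ₂, hγ₂, h20, rfl, rfl⟩ := h₂
  -- The first curve is run during `[0, 1/3]` and the second during `[2/3, 1]`. Between them both
  -- reparametrized curves rest at the common point, so the concatenation agrees near every time
  -- with one of two `C¹` curves.
  set ψ₁ : ℝ → ℝ := fun t => Real.smoothTransition (3 * t) with hψ₁
  set ψ₂ : ℝ → ℝ := fun t => Real.smoothTransition (3 * t - 2) with hψ₂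
  have hc₁ : ContDiff ℝ 1 ψ₁ := Real.smoothTransition.contDiff.comp (by fun_prop)
  have hc₂ : ContDiff ℝ 1 ψ₂ := Real.smoothTransition.contDiff.comp (by fun_prop)
  have hm₁ : Monotone ψ₁ := fun s t hst => Real.smoothTransition.monotone (by linarith)
  have hm₂ : Monotone ψ₂ := fun s t hst => Real.smoothTransition.monotone (by linarith)
  have hi₁ : ∀ t, ψ₁ t ∈ Icc (0 : ℝ) 1 := fun t =>
    ⟨Real.smoothTransition.nonneg _, Real.smoothTransition.le_one _⟩
  have hi₂ : ∀ t, ψ₂ t ∈ Icc (0 : ℝ) 1 := fun t =>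
    ⟨Real.smoothTransition.nonneg _, Real.smoothTransition.le_one _⟩
  have h1 : ∀ t, 1 / 3 ≤ t → ψ₁ t = 1 := fun t ht =>
    Real.smoothTransition.one_of_one_le (by linarith)
  have h2 : ∀ t, t ≤ 2 / 3 → ψ₂ t = 0 := fun t ht =>
    Real.smoothTransition.zero_of_nonpos (by linarith)
  set γ : ℝ → M := fun t => if t ≤ 1 / 2 then γ₁ (ψ₁ t) else γ₂ (ψ₂ t) with hγ
  have e1 : ∀ t < 2 / 3, γ t = (γ₁ ∘ ψ₁) t := by
    intro t ht
    simp only [hγ, Function.comp_apply]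
    split_ifs with h
    · rfl
    · rw [h2 t ht.le, h1 t (by linarith), h20]
  have e2 : ∀ t > 1 / 3, γ t = (γ₂ ∘ ψ₂) t := by
    intro t ht
    simp only [hγ, Function.comp_apply]
    split_ifs with h
    · rw [h2 t (by linarith), h1 t ht.le, h20]
    · rfl
  have E1 : ∀ t < 2 / 3, γ =ᶠ[𝓝 t] γ₁ ∘ ψ₁ := fun t ht => by
    filter_upwards [gt_mem_nhds ht] with s hs using e1 s hs
  have E2 : ∀ t > 1 / 3, γ =ᶠ[𝓝 t] γ₂ ∘ ψ₂ := fun t ht => by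
    filter_upwards [lt_mem_nhds ht] with s hs using e2 s hs
  have s1 : ContMDiff 𝓘(ℝ, ℝ) (𝓡 n) 1 (γ₁ ∘ ψ₁) :=
    contMDiffOn_univ.1 (hγ₁.comp hc₁.contMDiff.contMDiffOn fun t _ => hi₁ t)
  have s2 : ContMDiff 𝓘(ℝ, ℝ) (𝓡 n) 1 (γ₂ ∘ ψ₂) :=
    contMDiffOn_univ.1 (hγ₂.comp hc₂.contMDiff.contMDiffOn fun t _ => hi₂ t)
  have hs : ContMDiff 𝓘(ℝ, ℝ) (𝓡 n) 1 γ := by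
    intro t
    rcases lt_or_ge t (2 / 3) with ht | ht
    · exact (s1 t).congr_of_eventuallyEq (E1 t ht)
    · exact (s2 t).congr_of_eventuallyEq (E2 t (by linarith))
  refine ⟨γ, hs.contMDiffOn, ?_, ?_, ?_⟩
  · rw [e1 0 (by norm_num)]
    simp [hψ₁]
  · rw [e2 1 (by norm_num)]
    have : ψ₂ 1 = 1 := Real.smoothTransition.one_of_one_le (by norm_num)
    simp [this]
  · rw [F.length_eq_intervalIntegral γ]
    have hint := fun a b => (F.continuous_speed hs).intervalIntegrable (μ := volume) a b
    rw [← intervalIntegral.integral_add_adjacent_intervals (hint 0 (1 / 2)) (hint (1 / 2) 1)]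
    congr 1
    · rw [← F.integral_speed_comp hγ₁ hc₁ hm₁ hi₁ (a := 0) (b := 1 / 2)
        (by simp [hψ₁]) (h1 _ (by norm_num))]
      refine intervalIntegral.integral_congr fun t ht => ?_
      rw [uIcc_of_le (by norm_num)] at ht
      exact (F.speed_congr (E1 t (by linarith [ht.2]))).symm
    · rw [← F.integral_speed_comp hγ₂ hc₂ hm₂ hi₂ (a := 1 / 2) (b := 1)
        (h2 _ (by norm_num)) (Real.smoothTransition.one_of_one_le (by norm_num))]
      refine intervalIntegral.integral_congr fun t ht => ?_
      rw [uIcc_of_le (by norm_num)] at ht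
      exact (F.speed_congr (E2 t (by linarith [ht.1]))).symm

theorem isCurveLength_refl (x : M) : F.IsCurveLength x x 0 := by
  refine ⟨fun _ => x, contMDiffOn_const, rfl, rfl, ?_⟩
  have h : ∀ t : ℝ, F.toFun x
      (mfderivWithin 𝓘(ℝ, ℝ) (𝓡 n) (fun _ : ℝ => x) (Icc (0 : ℝ) 1) t (1 : ℝ)) = 0 := by
    intro t
    rw [mfderivWithin_const]
    exact F.apply_zero x
  simp only [length, h, integral_zero]

variable (F)

/-- A chart ball on which the metric is multiplicatively close to a fixed positively homogeneous
function `b`, together with the resulting bound on the length of coordinate segments. -/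
theorem exists_chart_ball (p : M) {η : ℝ} (hη : 0 < η) :
    ∃ (R : ℝ) (b : EuclideanSpace ℝ (Fin n) → ℝ), 0 < R ∧
      (∀ (c : ℝ) (v), 0 ≤ c → b (c • v) = c * b v) ∧
      (∃ c > 0, ∀ v, c * ‖v‖ ≤ b v) ∧ (∃ C > 0, ∀ v, b v ≤ C * ‖v‖) ∧
      Metric.ball (extChartAt (𝓡 n) p p) R ⊆ (extChartAt (𝓡 n) p).target ∧
      (∀ x ∈ (extChartAt (𝓡 n) p).source,
        extChartAt (𝓡 n) p x ∈ Metric.ball (extChartAt (𝓡 n) p p) R →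
        ∀ y : TangentSpace (𝓡 n) x, F.toFun x y ≤
          b (mfderiv (𝓡 n) 𝓘(ℝ, EuclideanSpace ℝ (Fin n)) (extChartAt (𝓡 n) p) x y) ∧
          b (mfderiv (𝓡 n) 𝓘(ℝ, EuclideanSpace ℝ (Fin n)) (extChartAt (𝓡 n) p) x y) ≤
            (1 + η) * F.toFun x y) ∧
      ∀ x ∈ (extChartAt (𝓡 n) p).source, ∀ z ∈ (extChartAt (𝓡 n) p).source,
        extChartAt (𝓡 n) p x ∈ Metric.ball (extChartAt (𝓡 n) p p) R →
        extChartAt (𝓡 n) p z ∈ Metric.ball (extChartAt (𝓡 n) p p) R →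
        ∃ ℓ ≤ b (extChartAt (𝓡 n) p z - extChartAt (𝓡 n) p x), F.IsCurveLength x z ℓ := by
  obtain ⟨b, hb, hc, hC, hev⟩ := F.exists_local_bound p hη
  set e := extChartAt (𝓡 n) p with he
  have ht : e.target ∈ 𝓝 (e p) := extChartAt_target_mem_nhds p
  have hsymm : ContinuousAt e.symm (e p) := continuousAt_extChartAt_symm p
  have hep : e.symm (e p) = p := extChartAt_to_inv p
  have hev' : ∀ᶠ w in 𝓝 (e p), ∀ y : TangentSpace (𝓡 n) (e.symm w), F.toFun (e.symm w) y ≤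
          b (mfderiv (𝓡 n) 𝓘(ℝ, EuclideanSpace ℝ (Fin n)) e (e.symm w) y) ∧
          b (mfderiv (𝓡 n) 𝓘(ℝ, EuclideanSpace ℝ (Fin n)) e (e.symm w) y) ≤
            (1 + η) * F.toFun (e.symm w) y := by
    have := hsymm.tendsto
    rw [hep] at this
    exact this.eventually hev
  obtain ⟨R, hR, hball⟩ := Metric.eventually_nhds_iff_ball.1 (hev'.and ht)
  have hbd : ∀ x ∈ e.source, e x ∈ Metric.ball (e p) R →
        ∀ y : TangentSpace (𝓡 n) x, F.toFun x y ≤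
          b (mfderiv (𝓡 n) 𝓘(ℝ, EuclideanSpace ℝ (Fin n)) e x y) ∧
          b (mfderiv (𝓡 n) 𝓘(ℝ, EuclideanSpace ℝ (Fin n)) e x y) ≤
            (1 + η) * F.toFun x y := by
    intro x hx hxR
    have h := (hball _ hxR).1
    rw [e.left_inv hx] at h
    exact h
  refine ⟨R, b, hR, hb, hc, hC, fun w hw => (hball w hw).2, hbd, ?_⟩
  intro x hx z hz hxR hzR
  set σ : ℝ → EuclideanSpace ℝ (Fin n) := fun t => e x + t • (e z - e x) with hσ
  have hσR : ∀ t ∈ Icc (0 : ℝ) 1, σ t ∈ Metric.ball (e p) R := by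
    intro t ht
    exact (convex_ball (e p) R).add_smul_sub_mem hxR hzR ht
  have hσt : ∀ t ∈ Icc (0 : ℝ) 1, σ t ∈ e.target := fun t ht => (hball _ (hσR t ht)).2
  have hσd : ∀ t, HasDerivAt σ (e z - e x) t := by
    intro t
    have := ((hasDerivAt_id t).smul_const (e z - e x)).const_add (e x)
    rw [one_smul] at this
    exact this
  have hσc : ContDiff ℝ 1 σ := by fun_prop
  have hγc : ContMDiffOn 𝓘(ℝ, ℝ) (𝓡 n) 1 (e.symm ∘ σ) (Icc 0 1) :=
    (contMDiffOn_extChartAt_symm p).comp hσc.contMDiff.contMDiffOn hσt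
  refine ⟨F.length (e.symm ∘ σ), ?_, e.symm ∘ σ, hγc, ?_, ?_, rfl⟩
  · have hsp : ∀ t ∈ Icc (0 : ℝ) 1, F.toFun ((e.symm ∘ σ) t)
        (mfderivWithin 𝓘(ℝ, ℝ) (𝓡 n) (e.symm ∘ σ) (Icc (0 : ℝ) 1) t (1 : ℝ)) ≤
        b (e z - e x) := by
      intro t ht
      have hs : (e.symm ∘ σ) t ∈ e.source := e.map_target (hσt t ht)
      have her : e ((e.symm ∘ σ) t) = σ t := e.right_inv (hσt t ht)
      refine (hbd _ hs (by rw [her]; exact hσR t ht) _).1.trans_eq ?_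
      -- In the chart the curve is the segment `σ`, so its coordinate velocity is the constant `e z
      -- - e x`.
      congr 1
      have hu : UniqueMDiffWithinAt 𝓘(ℝ, ℝ) (Icc (0 : ℝ) 1) t :=
        (uniqueDiffOn_Icc (zero_lt_one' ℝ)).uniqueMDiffOn t ht
      have h1 := mfderiv_comp_mfderivWithin (I'' := 𝓘(ℝ, EuclideanSpace ℝ (Fin n))) (g := e) t
        (mdifferentiableAt_extChartAt (by simpa [he] using hs))
        ((hγc.mdifferentiableOn one_ne_zero) t ht) hu
      have h2 : HasMFDerivWithinAt 𝓘(ℝ, ℝ) 𝓘(ℝ, EuclideanSpace ℝ (Fin n)) (e ∘ e.symm ∘ σ)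
          (Icc (0 : ℝ) 1) t (ContinuousLinearMap.toSpanSingleton ℝ (e z - e x)) := by
        refine ((hσd t).hasFDerivAt.hasMFDerivAt.hasMFDerivWithinAt).congr_of_eventuallyEq ?_ her
        filter_upwards [self_mem_nhdsWithin] with s hs using e.right_inv (hσt s hs)
      rw [h2.mfderivWithin hu] at h1
      have h3 := congrArg (fun L : ℝ →L[ℝ] EuclideanSpace ℝ (Fin n) => L 1) h1
      refine Eq.trans h3.symm ?_
      exact ContinuousLinearMap.toSpanSingleton_apply_one ℝ (e z - e x)
    have h := setIntegral_mono_on (μ := volume)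
      (F.continuousOn_speedWithin hγc).integrableOn_Icc
      (integrableOn_const (C := b (e z - e x)) (by simp)) measurableSet_Icc hsp
    simpa [length] using h
  · simp only [hσ, Function.comp_apply, zero_smul, add_zero]
    exact e.left_inv hx
  · simp only [hσ, Function.comp_apply, one_smul, add_sub_cancel]
    exact e.left_inv hz

theorem bddBelow_curveLengths (x z : M) : BddBelow {ℓ | F.IsCurveLength x z ℓ} :=
  ⟨0, fun _ h => h.nonneg⟩

theorem dist_le_of_isCurveLength {x z : M} {ℓ : ℝ} (h : F.IsCurveLength x z ℓ) :
    F.dist x z ≤ ℓ :=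
  csInf_le (F.bddBelow_curveLengths x z) h

theorem dist_nonneg (x z : M) : 0 ≤ F.dist x z :=
  Real.sInf_nonneg fun _ (h : F.IsCurveLength x z _) => h.nonneg

theorem dist_self (x : M) : F.dist x x = 0 :=
  (F.dist_le_of_isCurveLength (isCurveLength_refl x)).antisymm (F.dist_nonneg x x)

/-- Points near `p` are joined to each other by short curves. -/
theorem eventually_isCurveLength (p : M) {ε : ℝ} (hε : 0 < ε) :
    ∀ᶠ x in 𝓝 p, (∃ ℓ < ε, F.IsCurveLength p x ℓ) ∧ ∃ ℓ < ε, F.IsCurveLength x p ℓ := by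
  obtain ⟨R, b, hR, -, -, ⟨C, hC0, hC⟩, -, -, hcurve⟩ := F.exists_chart_ball p one_pos
  have hs := extChartAt_source_mem_nhds (I := 𝓡 n) p
  have hcont := (continuousAt_extChartAt (I := 𝓡 n) p)
  have hδ : 0 < min R (ε / C) := lt_min hR (div_pos hε hC0)
  filter_upwards [hs, hcont.eventually (Metric.ball_mem_nhds _ hδ)] with x hxs hx
  rw [lt_min_iff, lt_div_iff₀ hC0] at hx
  obtain ⟨hxR, hxε⟩ := hx
  have hp := mem_extChartAt_source (I := 𝓡 n) p
  obtain ⟨ℓ₁, h₁, hl₁⟩ := hcurve p hp x hxs (Metric.mem_ball_self hR) hxR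
  obtain ⟨ℓ₂, h₂, hl₂⟩ := hcurve x hxs p hp hxR (Metric.mem_ball_self hR)
  rw [dist_eq_norm] at hxε
  refine ⟨⟨ℓ₁, ?_, hl₁⟩, ℓ₂, ?_, hl₂⟩
  · linarith [hC (extChartAt (𝓡 n) p x - extChartAt (𝓡 n) p p)]
  · have := hC (extChartAt (𝓡 n) p p - extChartAt (𝓡 n) p x)
    rw [norm_sub_rev] at this
    linarith

/-- Being joined by a curve is transitive and holds near each point in both directions, so
connectedness propagates it. Hence the infimum defining `dist` is never the default value of an
empty set. -/
theorem exists_isCurveLength [ConnectedSpace M] (x z : M) : ∃ ℓ, F.IsCurveLength x z ℓ := by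
  refine PreconnectedSpace.induction₂' (fun x z => ∃ ℓ, F.IsCurveLength x z ℓ) ?_
    ⟨fun x y z ⟨a, ha⟩ ⟨b, hb⟩ => ⟨a + b, ha.trans hb⟩⟩ x z
  intro x
  filter_upwards [F.eventually_isCurveLength x one_pos] with z hz
  obtain ⟨⟨a, -, ha⟩, b, -, hb⟩ := hz
  exact ⟨⟨a, ha⟩, b, hb⟩

theorem dist_triangle [ConnectedSpace M] (x y z : M) :
    F.dist x z ≤ F.dist x y + F.dist y z := by
  refine le_of_forall_pos_le_add fun ε hε => ?_
  obtain ⟨a, ha, ha'⟩ := exists_lt_of_csInf_lt (F.exists_isCurveLength x y)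
    (lt_add_of_pos_right (F.dist x y) (half_pos hε))
  obtain ⟨b, hb, hb'⟩ := exists_lt_of_csInf_lt (F.exists_isCurveLength y z)
    (lt_add_of_pos_right (F.dist y z) (half_pos hε))
  have := F.dist_le_of_isCurveLength (IsCurveLength.trans ha hb)
  linarith

theorem eventually_dist_lt (p : M) {ε : ℝ} (hε : 0 < ε) :
    ∀ᶠ x in 𝓝 p, F.dist p x < ε ∧ F.dist x p < ε := by
  filter_upwards [F.eventually_isCurveLength p hε] with x hx
  obtain ⟨⟨a, ha, ha'⟩, b, hb, hb'⟩ := hx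
  exact ⟨(F.dist_le_of_isCurveLength ha').trans_lt ha,
    (F.dist_le_of_isCurveLength hb').trans_lt hb⟩

theorem isOpen_forwardNhd [ConnectedSpace M] (A : Set M) (r : ℝ) :
    IsOpen (forwardNhd F.dist A r) := by
  refine isOpen_iff_mem_nhds.2 ?_
  rintro x ⟨z, hz, hzx⟩
  filter_upwards [F.eventually_dist_lt x (sub_pos.2 hzx)] with w hw
  exact ⟨z, hz, by linarith [F.dist_triangle z x w]⟩

theorem isOpen_backwardNhd [ConnectedSpace M] (A : Set M) (r : ℝ) :
    IsOpen (backwardNhd F.dist A r) := by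
  refine isOpen_iff_mem_nhds.2 ?_
  rintro x ⟨z, hz, hzx⟩
  filter_upwards [F.eventually_dist_lt x (sub_pos.2 hzx)] with w hw
  exact ⟨z, hz, by linarith [F.dist_triangle w x z]⟩

/-- The distance of a compact Finsler manifold is bounded. -/
theorem exists_dist_lt [CompactSpace M] [ConnectedSpace M] : ∃ D : ℝ, ∀ x z, F.dist x z < D := by
  obtain ⟨p⟩ := (inferInstance : Nonempty M)
  -- Distances to and from a single base point are locally bounded, hence bounded by compactness.
  have key : ∃ D : ℝ, ∀ x ∈ (univ : Set M), F.dist p x < D ∧ F.dist x p < D := by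
    refine isCompact_univ.induction_on (p := fun s => ∃ D : ℝ, ∀ x ∈ s,
      F.dist p x < D ∧ F.dist x p < D) ⟨0, by simp⟩ ?_ ?_ ?_
    · rintro s t hst ⟨D, hD⟩
      exact ⟨D, fun x hx => hD x (hst hx)⟩
    · rintro s t ⟨D, hD⟩ ⟨D', hD'⟩
      refine ⟨max D D', ?_⟩
      rintro x (hx | hx)
      · exact ⟨lt_max_of_lt_left (hD x hx).1, lt_max_of_lt_left (hD x hx).2⟩
      · exact ⟨lt_max_of_lt_right (hD' x hx).1, lt_max_of_lt_right (hD' x hx).2⟩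
    · intro x _
      refine ⟨_, mem_nhdsWithin_of_mem_nhds (F.eventually_dist_lt x one_pos),
        max (F.dist p x) (F.dist x p) + 1, ?_⟩
      rintro z ⟨h1, h2⟩
      constructor
      · linarith [F.dist_triangle p x z, le_max_left (F.dist p x) (F.dist x p)]
      · linarith [F.dist_triangle z x p, le_max_right (F.dist p x) (F.dist x p)]
  obtain ⟨D, hD⟩ := key
  refine ⟨D + D, fun x z => ?_⟩
  linarith [F.dist_triangle x p z, (hD x (mem_univ x)).2, (hD z (mem_univ z)).1]

end FinslerMetric

/-! ### Smoothing functions that are Lipschitz for an asymmetric distance -/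

/-- Mollification: a function on a ball whose increments are bounded by a positively homogeneous
function `b` is uniformly approximated, on a smaller ball, by smooth functions whose directional
derivatives are bounded by `b`. -/
theorem exists_contDiff_approx_of_increment_le {E : Type*} [NormedAddCommGroup E] [NormedSpace ℝ E]
    [FiniteDimensional ℝ E] {b : E → ℝ} (hb : ∀ (c : ℝ) (v), 0 ≤ c → b (c • v) = c * b v)
    {C : ℝ} (hC0 : 0 < C) (hC : ∀ v, b v ≤ C * ‖v‖) {g : E → ℝ} {x₀ : E} {R : ℝ} (hR : 0 < R)
    (hg : ∀ x ∈ Metric.ball x₀ R, ∀ z ∈ Metric.ball x₀ R, g z - g x ≤ b (z - x))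
    {η : ℝ} (hη : 0 < η) :
    ∃ h : E → ℝ, ContDiff ℝ ∞ h ∧ ∀ x ∈ Metric.ball x₀ (R / 2),
      |h x - g x| ≤ η ∧ ∀ v, fderiv ℝ h x v ≤ b v := by
  let _ : MeasurableSpace E := borel E
  have _ : BorelSpace E := ⟨rfl⟩
  set B := Metric.ball x₀ R with hB
  set μ : Measure E := Measure.addHaar with hμ
  have habs : ∀ x ∈ B, ∀ z ∈ B, |g z - g x| ≤ C * ‖z - x‖ := by
    intro x hx z hz
    refine abs_le.2 ⟨?_, (hg x hx z hz).trans (hC _)⟩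
    have := (hg z hz x hx).trans (hC _)
    rw [norm_sub_rev] at this
    linarith
  have hcont : ContinuousOn g B := by
    refine LipschitzOnWith.continuousOn (K := C.toNNReal)
      (LipschitzOnWith.of_dist_le_mul fun x hx z hz => ?_)
    rw [Real.dist_eq, dist_eq_norm, Real.coe_toNNReal _ hC0.le]
    exact habs z hz x hx
  have hint : Integrable (B.indicator g) μ := by
    rw [integrable_indicator_iff measurableSet_ball]
    have : IsFiniteMeasure (μ.restrict B) := isFiniteMeasure_restrict.2 measure_ball_lt_top.ne
    refine Integrable.of_bound (hcont.aestronglyMeasurable measurableSet_ball) (|g x₀| + C * R) ?_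
    refine (ae_restrict_iff' measurableSet_ball).2 (Eventually.of_forall fun x hx => ?_)
    have h1 := habs x₀ (Metric.mem_ball_self hR) x hx
    have h2 : ‖x - x₀‖ < R := by rwa [← dist_eq_norm]
    have h3 := abs_sub_abs_le_abs_sub (g x) (g x₀)
    rw [Real.norm_eq_abs]
    nlinarith [mul_lt_mul_of_pos_left h2 hC0]
  -- The bound `r ≤ R / 2` keeps the translates inside the large ball, and `C r ≤ η` bounds the
  -- oscillation of `g` at scale `r`.
  set r := min (R / 2) (η / C) with hr
  have hr0 : 0 < r := lt_min (half_pos hR) (div_pos hη hC0)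
  have hrR : r ≤ R / 2 := min_le_left _ _
  have hrη : C * r ≤ η := by
    have := min_le_right (R / 2) (η / C)
    rw [← hr, le_div_iff₀ hC0] at this
    linarith
  let φ : ContDiffBump (0 : E) := ⟨r / 2, r, half_pos hr0, half_lt_self hr0⟩
  have hball : ∀ x ∈ Metric.ball x₀ (R / 2), ∀ t : E, ‖t‖ < r → x - t ∈ B := by
    intro x hx t ht
    rw [Metric.mem_ball, dist_eq_norm] at hx ⊢
    calc ‖x - t - x₀‖ = ‖(x - x₀) - t‖ := by congr 1; abel
      _ ≤ ‖x - x₀‖ + ‖t‖ := norm_sub_le _ _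
      _ < R := by linarith
  have hsupp : ∀ t : E, φ.normed μ t ≠ 0 → ‖t‖ < r := by
    intro t ht
    have h1 : t ∈ Function.support (φ.normed μ) := ht
    rw [φ.support_normed_eq] at h1
    simpa using h1
  set h : E → ℝ := convolution (φ.normed μ) (B.indicator g) (ContinuousLinearMap.lsmul ℝ ℝ) μ
    with hh
  have hconv : ∀ x, Integrable (fun t => φ.normed μ t * B.indicator g (x - t)) μ := fun x =>
    φ.hasCompactSupport_normed.convolutionExists_left (ContinuousLinearMap.lsmul ℝ ℝ)
      φ.continuous_normed hint.locallyIntegrable x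
  have hval : ∀ x, h x = ∫ t, φ.normed μ t * B.indicator g (x - t) ∂μ := fun x => rfl
  have hsm : ContDiff ℝ ∞ h :=
    φ.hasCompactSupport_normed.contDiff_convolution_left (ContinuousLinearMap.lsmul ℝ ℝ)
      φ.contDiff_normed hint.locallyIntegrable
  refine ⟨h, hsm, fun x hx => ⟨?_, fun v => ?_⟩⟩
  · have hxB : x ∈ B := Metric.ball_subset_ball (by linarith) hx
    have h1 := φ.dist_normed_convolution_le (μ := μ) (g := B.indicator g) (x₀ := x) (ε := η)
      hint.aestronglyMeasurable (fun y hy => by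
        have hy' : ‖y - x‖ < r := by rwa [← dist_eq_norm]
        have hyB : y ∈ B := by
          have := hball x hx (x - y) (by rwa [norm_sub_rev])
          rwa [sub_sub_cancel] at this
        rw [indicator_of_mem hyB, indicator_of_mem hxB, Real.dist_eq]
        exact (habs x hxB y hyB).trans (by nlinarith [mul_lt_mul_of_pos_left hy' hC0]))
    rw [indicator_of_mem hxB, Real.dist_eq] at h1
    exact h1
  · have hline : HasLineDerivAt ℝ h (fderiv ℝ h x v) x v :=
      ((hsm.differentiable (by simp)) x).hasFDerivAt.hasLineDerivAt v
    -- Only right difference quotients are used: an increment of `h` along `s v`, `s > 0`, averages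
    -- increments of `g`, each at most `b (s v) = s b v`.
    refine le_of_tendsto hline.tendsto_slope_zero_right ?_
    have hnear : ∀ᶠ s : ℝ in 𝓝[>] 0, x + s • v ∈ Metric.ball x₀ (R / 2) := by
      have hc : ContinuousAt (fun s : ℝ => x + s • v) 0 := by fun_prop
      refine nhdsWithin_le_nhds (hc.eventually (Metric.isOpen_ball.mem_nhds ?_))
      simpa using hx
    filter_upwards [hnear, self_mem_nhdsWithin] with s hs hs0
    have hs0' : (0 : ℝ) < s := hs0
    have hle : h (x + s • v) - h x ≤ s * b v := by
      rw [hval, hval, ← integral_sub (hconv _) (hconv _)]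
      have h1 : ∫ t, φ.normed μ t * (s * b v) ∂μ = s * b v := by
        rw [integral_mul_const, φ.integral_normed, one_mul]
      rw [← h1]
      refine integral_mono ((hconv _).sub (hconv _)) (φ.integrable_normed.mul_const _) fun t => ?_
      show φ.normed μ t * B.indicator g (x + s • v - t) - φ.normed μ t * B.indicator g (x - t) ≤ _
      rw [← mul_sub]
      by_cases ht : φ.normed μ t = 0
      · simp [ht]
      · have htr := hsupp t ht
        have m1 := hball _ hs t htr
        have m2 := hball _ hx t htr
        rw [indicator_of_mem m1, indicator_of_mem m2]
        refine mul_le_mul_of_nonneg_left ?_ (φ.nonneg_normed t)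
        refine (hg _ m2 _ m1).trans_eq ?_
        rw [← hb s v hs0'.le]
        congr 1
        abel
    rw [smul_eq_mul, inv_mul_le_iff₀ hs0']
    exact hle

namespace FinslerMetric

variable {n : ℕ} {M : Type*} [TopologicalSpace M] [ChartedSpace (EuclideanSpace ℝ (Fin n)) M]

/-- The differential of a real-valued function, as a covector. -/
noncomputable def differential (u : M → ℝ) (x : M) : TangentSpace (𝓡 n) x →L[ℝ] ℝ :=
  mfderiv (𝓡 n) 𝓘(ℝ, ℝ) u x

theorem hasMFDerivAt_differential {u : M → ℝ} {x : M}
    (h : MDifferentiableAt (𝓡 n) 𝓘(ℝ, ℝ) u x) :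
    HasMFDerivAt (𝓡 n) 𝓘(ℝ, ℝ) u x (differential u x) :=
  h.hasMFDerivAt

theorem differential_congr {u v : M → ℝ} {x : M} (h : u =ᶠ[𝓝 x] v) :
    differential (n := n) u x = differential v x :=
  h.mfderiv_eq

theorem differential_const (c : ℝ) (x : M) : differential (n := n) (fun _ : M => c) x = 0 :=
  mfderiv_const

theorem differential_mul {u v : M → ℝ} {x : M} (hu : MDifferentiableAt (𝓡 n) 𝓘(ℝ, ℝ) u x)
    (hv : MDifferentiableAt (𝓡 n) 𝓘(ℝ, ℝ) v x) (y : TangentSpace (𝓡 n) x) :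
    differential (fun x => u x * v x) x y = u x * differential v x y + v x * differential u x y := by
  have h := (HasMFDerivAt.mul (hasMFDerivAt_differential hu) (hasMFDerivAt_differential hv)).mfderiv
  exact congrArg (fun L : EuclideanSpace ℝ (Fin n) →L[ℝ] ℝ => L y) h

theorem differential_add {u v : M → ℝ} {x : M} (hu : MDifferentiableAt (𝓡 n) 𝓘(ℝ, ℝ) u x)
    (hv : MDifferentiableAt (𝓡 n) 𝓘(ℝ, ℝ) v x) (y : TangentSpace (𝓡 n) x) :
    differential (fun x => u x + v x) x y = differential u x y + differential v x y := by
  have h := (HasMFDerivAt.add (hasMFDerivAt_differential hu) (hasMFDerivAt_differential hv)).mfderiv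
  exact congrArg (fun L : EuclideanSpace ℝ (Fin n) →L[ℝ] ℝ => L y) h

theorem differential_sum {ι : Type*} {u : ι → M → ℝ} {x : M}
    (hu : ∀ i, MDifferentiableAt (𝓡 n) 𝓘(ℝ, ℝ) (u i) x) (y : TangentSpace (𝓡 n) x)
    (s : Finset ι) :
    MDifferentiableAt (𝓡 n) 𝓘(ℝ, ℝ) (fun x => ∑ i ∈ s, u i x) x ∧
      differential (fun x => ∑ i ∈ s, u i x) x y = ∑ i ∈ s, differential (u i) x y := by
  classical
  induction s using Finset.induction_on with
  | empty =>
    simp only [Finset.sum_empty, differential_const]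
    exact ⟨mdifferentiableAt_const, rfl⟩
  | insert i s hi ih =>
    simp only [Finset.sum_insert hi]
    exact ⟨(hu i).add ih.1, by rw [differential_add (hu i) ih.1, ih.2]⟩

theorem differential_comp {u : M → ℝ} {x : M} {w : ℝ → ℝ}
    (hw : DifferentiableAt ℝ w (u x)) (hu : MDifferentiableAt (𝓡 n) 𝓘(ℝ, ℝ) u x)
    (y : TangentSpace (𝓡 n) x) :
    differential (w ∘ u) x y = deriv w (u x) * differential u x y := by
  have h := (HasMFDerivAt.comp x hw.hasFDerivAt.hasMFDerivAt (hasMFDerivAt_differential hu)).mfderiv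
  refine (congrArg (fun L : EuclideanSpace ℝ (Fin n) →L[ℝ] ℝ => L y) h).trans ?_
  show fderiv ℝ w (u x) (differential u x y) = _
  rw [mul_comm]
  exact fderiv_eq_smul_deriv _

variable [IsManifold (𝓡 n) ∞ M]

theorem mdifferentiableAt_comp_chart {p x : M} (hx : x ∈ (extChartAt (𝓡 n) p).source)
    {g : EuclideanSpace ℝ (Fin n) → ℝ} (hg : DifferentiableAt ℝ g (extChartAt (𝓡 n) p x)) :
    MDifferentiableAt (𝓡 n) 𝓘(ℝ, ℝ) (fun x => g (extChartAt (𝓡 n) p x)) x :=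
  hg.mdifferentiableAt.comp x (mdifferentiableAt_extChartAt (by simpa using hx))

theorem differential_comp_chart {p x : M} (hx : x ∈ (extChartAt (𝓡 n) p).source)
    {g : EuclideanSpace ℝ (Fin n) → ℝ} (hg : DifferentiableAt ℝ g (extChartAt (𝓡 n) p x))
    (y : TangentSpace (𝓡 n) x) :
    differential (fun x => g (extChartAt (𝓡 n) p x)) x y =
      fderiv ℝ g (extChartAt (𝓡 n) p x)
        (mfderiv (𝓡 n) 𝓘(ℝ, EuclideanSpace ℝ (Fin n)) (extChartAt (𝓡 n) p) x y) := by
  have h := (HasMFDerivAt.comp x hg.hasFDerivAt.hasMFDerivAt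
    (mdifferentiableAt_extChartAt (I := 𝓡 n) (x := p) (by simpa using hx)).hasMFDerivAt).mfderiv
  exact congrArg (fun L : EuclideanSpace ℝ (Fin n) →L[ℝ] ℝ => L y) h

variable (F : FinslerMetric n M)

/-- On a compact manifold the differential of a smooth function is bounded by a multiple of the
metric. -/
theorem exists_abs_differential_le [CompactSpace M] {u : M → ℝ}
    (hu : ContMDiff (𝓡 n) 𝓘(ℝ, ℝ) ∞ u) :
    ∃ K : ℝ, 0 ≤ K ∧ ∀ x (y : TangentSpace (𝓡 n) x), |differential u x y| ≤ K * F.toFun x y := by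
  have key : ∃ K : ℝ, 0 ≤ K ∧ ∀ x ∈ (univ : Set M), ∀ y : TangentSpace (𝓡 n) x,
      |differential u x y| ≤ K * F.toFun x y := by
    refine isCompact_univ.induction_on (p := fun s => ∃ K : ℝ, 0 ≤ K ∧ ∀ x ∈ s,
      ∀ y : TangentSpace (𝓡 n) x, |differential u x y| ≤ K * F.toFun x y) ⟨0, le_rfl, by simp⟩
      ?_ ?_ ?_
    · rintro s t hst ⟨K, hK0, hK⟩
      exact ⟨K, hK0, fun x hx => hK x (hst hx)⟩
    · rintro s t ⟨K, hK0, hK⟩ ⟨K', hK0', hK'⟩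
      refine ⟨max K K', le_max_of_le_left hK0, ?_⟩
      rintro x (hx | hx) y
      · exact (hK x hx y).trans (mul_le_mul_of_nonneg_right (le_max_left _ _) (F.nonneg x y))
      · exact (hK' x hx y).trans (mul_le_mul_of_nonneg_right (le_max_right _ _) (F.nonneg x y))
    · intro p _
      set e := extChartAt (𝓡 n) p with he
      obtain ⟨b, -, ⟨c, hc0, hc⟩, -, hbd⟩ := F.exists_local_bound p one_pos
      have hg : ContDiffOn ℝ ∞ (u ∘ e.symm) e.target :=
        contMDiffOn_iff_contDiffOn.1 (hu.comp_contMDiffOn (contMDiffOn_extChartAt_symm p))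
      have hopen : IsOpen e.target := isOpen_extChartAt_target p
      have hpt : e p ∈ e.target := mem_extChartAt_target p
      have hdc : ContinuousAt (fderiv ℝ (u ∘ e.symm)) (e p) :=
        (hg.continuousOn_fderiv_of_isOpen hopen (by simp)).continuousAt (hopen.mem_nhds hpt)
      have hbdd : ∀ᶠ x in 𝓝 p, ‖fderiv ℝ (u ∘ e.symm) (e x)‖ <
          ‖fderiv ℝ (u ∘ e.symm) (e p)‖ + 1 :=
        ((hdc.comp (continuousAt_extChartAt (I := 𝓡 n) p)).norm).eventually
          (gt_mem_nhds (lt_add_one _))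
      set K := ‖fderiv ℝ (u ∘ e.symm) (e p)‖ + 1 with hK
      have hK0 : 0 ≤ K := by positivity
      have hmem := (hbd.and hbdd).and
        ((isOpen_extChartAt_source (I := 𝓡 n) p).mem_nhds (mem_extChartAt_source p))
      -- In coordinates `|du(v)| ≤ K ‖v‖` and `c ‖v‖ ≤ b v ≤ 2 F`; the factor `2` is `1 + η` with `η
      -- = 1`.
      refine ⟨_, mem_nhdsWithin_of_mem_nhds hmem, K / c * 2, by positivity, ?_⟩
      rintro x ⟨⟨hx1, hx2⟩, hxs⟩ y
      have hdx : DifferentiableAt ℝ (u ∘ e.symm) (e x) :=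
        ((hg.differentiableOn (by simp)).differentiableAt (hopen.mem_nhds (e.map_source hxs)))
      have hcongr : u =ᶠ[𝓝 x] fun x => (u ∘ e.symm) (e x) := by
        filter_upwards [(isOpen_extChartAt_source (I := 𝓡 n) p).mem_nhds hxs] with z hz
        exact (congrArg u (e.left_inv hz)).symm
      rw [differential_congr hcongr, differential_comp_chart hxs hdx y]
      obtain ⟨v, hv⟩ : ∃ v : EuclideanSpace ℝ (Fin n), v =
        mfderiv (𝓡 n) 𝓘(ℝ, EuclideanSpace ℝ (Fin n)) e x y := ⟨_, rfl⟩
      have h2 := (hx1 y).2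
      erw [← hv] at h2 ⊢
      have h3 : |fderiv ℝ (u ∘ e.symm) (e x) v| ≤ K * ‖v‖ :=
        ((fderiv ℝ (u ∘ e.symm) (e x)).le_opNorm v).trans
          (mul_le_mul_of_nonneg_right hx2.le (norm_nonneg v))
      have h4 : ‖v‖ ≤ 2 * F.toFun x y / c := by
        rw [le_div_iff₀ hc0]
        linarith [hc v]
      refine h3.trans ((mul_le_mul_of_nonneg_left h4 hK0).trans_eq ?_)
      ring
  obtain ⟨K, hK0, hK⟩ := key
  exact ⟨K, hK0, fun x => hK x (mem_univ x)⟩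

/-- A function which is `1`-Lipschitz for the asymmetric distance is uniformly approximated by
smooth functions with almost the same bound on the differential. -/
theorem exists_contMDiff_approx [T2Space M] [CompactSpace M] {f : M → ℝ}
    (hf : ∀ x z, f z - f x ≤ F.dist x z) {δ : ℝ} (hδ : 0 < δ) :
    ∃ h : M → ℝ, ContMDiff (𝓡 n) 𝓘(ℝ, ℝ) ∞ h ∧ ∀ x, |h x - f x| ≤ δ ∧
      ∀ y : TangentSpace (𝓡 n) x, differential h x y ≤ (1 + δ) * F.toFun x y := by
  -- Half of the slack `δ` pays for freezing the metric in charts, the other half for the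
  -- derivatives of the partition of unity.
  choose R b hR hb _ hC htarget hbd hcurve using
    fun p : M => F.exists_chart_ball p (half_pos hδ)
  choose C hC0 hC using hC
  set U : M → Set M := fun p => (extChartAt (𝓡 n) p).source ∩
    extChartAt (𝓡 n) p ⁻¹' Metric.ball (extChartAt (𝓡 n) p p) (R p / 2) with hU
  have hUo : ∀ p, IsOpen (U p) := fun p =>
    (continuousOn_extChartAt p).isOpen_inter_preimage (isOpen_extChartAt_source p)
      Metric.isOpen_ball
  have hUp : ∀ p, p ∈ U p := fun p =>
    ⟨mem_extChartAt_source p, Metric.mem_ball_self (half_pos (hR p))⟩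
  obtain ⟨t, ht⟩ := isCompact_univ.elim_finite_subcover U hUo
    fun p _ => mem_iUnion.2 ⟨p, hUp p⟩
  obtain ⟨χ, hχ⟩ := SmoothPartitionOfUnity.exists_isSubordinate (𝓡 n) isClosed_univ
    (fun i : t => U i) (fun i => hUo i) (by
      intro x hx
      obtain ⟨p, hp⟩ := mem_iUnion.1 (ht hx)
      obtain ⟨hpt, hxp⟩ := mem_iUnion.1 hp
      exact mem_iUnion.2 ⟨⟨p, hpt⟩, hxp⟩)
  have hχsm : ∀ i, ContMDiff (𝓡 n) 𝓘(ℝ, ℝ) ∞ (χ i) := fun i => (χ i).contMDiff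
  have hχsum : ∀ x, ∑ i, χ i x = 1 := fun x => by
    rw [← finsum_eq_sum_of_fintype]
    exact χ.sum_eq_one (mem_univ x)
  choose K hK0 hK using fun i : t => F.exists_abs_differential_le (hχsm i)
  set Kt := ∑ i, K i with hKt
  have hKt0 : 0 ≤ Kt := Finset.sum_nonneg fun i _ => hK0 i
  -- The local approximations must be close enough that the error `η ∑ K i` from differentiating the
  -- partition is at most `δ / 2`.
  set η := min δ (δ / 2 / (Kt + 1)) with hη
  have hη0 : 0 < η := lt_min hδ (by positivity)
  have hηδ : η ≤ δ := min_le_left _ _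
  have hηK : η * Kt ≤ δ / 2 := by
    have h1 : η ≤ δ / 2 / (Kt + 1) := min_le_right _ _
    rw [le_div_iff₀ (by positivity)] at h1
    nlinarith
  have hloc : ∀ p : M, ∃ g : EuclideanSpace ℝ (Fin n) → ℝ, ContDiff ℝ ∞ g ∧
      ∀ w ∈ Metric.ball (extChartAt (𝓡 n) p p) (R p / 2),
        |g w - (f ∘ (extChartAt (𝓡 n) p).symm) w| ≤ η ∧ ∀ v, fderiv ℝ g w v ≤ b p v := by
    intro p
    refine exists_contDiff_approx_of_increment_le (hb p) (hC0 p) (hC p) (hR p) ?_ hη0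
    intro x hx z hz
    have hxt := htarget p hx
    have hzt := htarget p hz
    obtain ⟨ℓ, hℓ, hcur⟩ := hcurve p _ ((extChartAt (𝓡 n) p).map_target hxt) _
      ((extChartAt (𝓡 n) p).map_target hzt)
      (by rwa [(extChartAt (𝓡 n) p).right_inv hxt]) (by rwa [(extChartAt (𝓡 n) p).right_inv hzt])
    rw [(extChartAt (𝓡 n) p).right_inv hxt, (extChartAt (𝓡 n) p).right_inv hzt] at hℓ
    exact (hf _ _).trans ((F.dist_le_of_isCurveLength hcur).trans hℓ)
  choose g hgsm hg using hloc
  have hUi : ∀ (i : t) (x), x ∈ tsupport (χ i) → x ∈ U i := fun i x hx => hχ i hx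
  set hc : t → M → ℝ := fun i x => g i (extChartAt (𝓡 n) (i : M) x) with hhc
  have hcf : ∀ (i : t), ∀ x ∈ U i, |hc i x - f x| ≤ η := by
    intro i x hx
    have h1 := (hg i _ hx.2).1
    rwa [Function.comp_apply, (extChartAt (𝓡 n) (i : M)).left_inv hx.1] at h1
  have hcd : ∀ (i : t), ∀ x ∈ U i, ∀ y : TangentSpace (𝓡 n) x,
      differential (hc i) x y ≤ (1 + δ / 2) * F.toFun x y := by
    intro i x hx y
    rw [differential_comp_chart hx.1 ((hgsm i).differentiable (by simp) _) y]
    refine ((hg i _ hx.2).2 _).trans ?_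
    exact (hbd i x hx.1 (Metric.ball_subset_ball (by linarith [hR i]) hx.2) y).2
  have husm : ∀ i : t, ContMDiff (𝓡 n) 𝓘(ℝ, ℝ) ∞ fun x => χ i x * hc i x := by
    intro i
    refine χ.contMDiff_smul (g := hc i) fun x hx => ?_
    exact ((hgsm i).contMDiff.contMDiffAt).comp x
      (contMDiffAt_extChartAt' (by simpa using (hUi i x hx).1))
  refine ⟨fun x => ∑ i, χ i x * hc i x, ContMDiff.sum fun i _ => husm i, fun x => ⟨?_, fun y => ?_⟩⟩
  · have h1 : ∑ i, χ i x * hc i x - f x = ∑ i, χ i x * (hc i x - f x) := by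
      simp only [mul_sub, Finset.sum_sub_distrib, ← Finset.sum_mul, hχsum x, one_mul]
    rw [h1]
    refine (Finset.abs_sum_le_sum_abs _ _).trans ?_
    have h2 : ∑ i, χ i x * η = η := by rw [← Finset.sum_mul, hχsum x, one_mul]
    refine le_trans ?_ (h2.le.trans hηδ)
    refine Finset.sum_le_sum fun i _ => ?_
    rw [abs_mul, abs_of_nonneg (χ.nonneg i x)]
    rcases eq_or_ne (χ i x) 0 with h0 | h0
    · simp [h0]
    · exact mul_le_mul_of_nonneg_left
        (hcf i x (hUi i x (subset_tsupport _ h0))) (χ.nonneg i x)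
  · rw [(differential_sum (fun i => (husm i).mdifferentiable (by simp) x) y Finset.univ).2]
    have hF := F.nonneg x y
    -- Since `∑ dχᵢ = 0`, the number `f x` may be subtracted: `d(∑ χᵢ hᵢ) = ∑ χᵢ dhᵢ + ∑ (hᵢ - f x)
    -- dχᵢ`. No derivative of `f` occurs.
    have hzero : ∑ i, differential (χ i) x y = 0 := by
      rw [← (differential_sum (fun i => (hχsm i).mdifferentiable (by simp) x) y Finset.univ).2]
      simp only [hχsum, differential_const]
      rfl
    have hterm : ∀ i, differential (fun x => χ i x * hc i x) x y - f x * differential (χ i) x y ≤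
        χ i x * ((1 + δ / 2) * F.toFun x y) + η * (K i * F.toFun x y) := by
      intro i
      have hKF : 0 ≤ K i * F.toFun x y := mul_nonneg (hK0 i) hF
      by_cases hx : x ∈ tsupport (χ i)
      · have hxU := hUi i x hx
        rw [differential_mul ((hχsm i).mdifferentiable (by simp) x)
          (mdifferentiableAt_comp_chart hxU.1 ((hgsm i).differentiable (by simp) _))]
        have h1 := mul_le_mul_of_nonneg_left (hcd i x hxU y) (χ.nonneg i x)
        have h2 : (hc i x - f x) * differential (χ i) x y ≤ η * (K i * F.toFun x y) := by
          refine (le_abs_self _).trans ?_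
          rw [abs_mul]
          exact mul_le_mul (hcf i x hxU) (hK i x y) (abs_nonneg _) hη0.le
        linarith
      · have h0 : (χ i : M → ℝ) =ᶠ[𝓝 x] fun _ => 0 := notMem_tsupport_iff_eventuallyEq.1 hx
        have h0' : (fun x => χ i x * hc i x) =ᶠ[𝓝 x] fun _ => 0 := by
          filter_upwards [h0] with z hz
          rw [hz, zero_mul]
        rw [differential_congr h0, differential_congr h0', differential_const]
        have : 0 ≤ χ i x * ((1 + δ / 2) * F.toFun x y) :=
          mul_nonneg (χ.nonneg i x) (by positivity)
        have h3 : 0 ≤ η * (K i * F.toFun x y) := mul_nonneg hη0.le hKF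
        simp only [zero_apply]
        linarith
    have hsum := Finset.sum_le_sum (s := Finset.univ) fun i _ => hterm i
    rw [Finset.sum_sub_distrib, ← Finset.mul_sum, hzero, Finset.sum_add_distrib, ← Finset.sum_mul,
      hχsum x, ← Finset.mul_sum, ← Finset.sum_mul] at hsum
    have h4 := mul_le_mul_of_nonneg_right hηK hF
    nlinarith

end FinslerMetric

/-! ### The spectral inequality for separated sets -/

/-- A smooth nondecreasing `1`-Lipschitz function which is constant near `(-∞, 0]` and near
`[ε, ∞)`, with almost the largest possible increment. -/
theorem exists_smooth_clamp {ε δ : ℝ} (hδ : 0 < δ) (hδε : 4 * δ < ε) :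
    ∃ (Ψ : ℝ → ℝ) (c : ℝ), ContDiff ℝ ∞ Ψ ∧ (∀ t, 0 ≤ deriv Ψ t ∧ deriv Ψ t ≤ 1) ∧
      (∀ t, t ≤ δ → Ψ t = 0 ∧ deriv Ψ t = 0) ∧ (∀ t, ε - δ ≤ t → Ψ t = c ∧ deriv Ψ t = 0) ∧
      ε - 4 * δ ≤ c := by
  -- The bump `w` is `Ψ'`: it equals `1` on `[2δ, ε - 2δ]` and `0` outside `(δ, ε - δ)`, so the
  -- total increment is at least `ε - 4δ`.
  let w : ContDiffBump (ε / 2 : ℝ) :=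
    ⟨ε / 2 - 2 * δ, ε / 2 - δ, by linarith, by linarith⟩
  have hwc : Continuous w := w.continuous
  have hint : ∀ a b, IntervalIntegrable w volume a b := fun a b => hwc.intervalIntegrable a b
  have hderiv : ∀ t, HasDerivAt (fun t => ∫ s in (0 : ℝ)..t, w s) (w t) t := fun t =>
    intervalIntegral.integral_hasDerivAt_right (hint 0 t)
      hwc.stronglyMeasurable.stronglyMeasurableAtFilter hwc.continuousAt
  have hd : deriv (fun t => ∫ s in (0 : ℝ)..t, w s) = w := funext fun t => (hderiv t).deriv
  have hlow : ∀ t, t ≤ δ → w t = 0 := fun t ht => w.zero_of_le_dist (by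
    rw [Real.dist_eq, abs_of_nonpos (by linarith)]
    show ε / 2 - δ ≤ _
    linarith)
  have hhigh : ∀ t, ε - δ ≤ t → w t = 0 := fun t ht => w.zero_of_le_dist (by
    rw [Real.dist_eq, abs_of_nonneg (by linarith)]
    show ε / 2 - δ ≤ _
    linarith)
  have hmid : ∀ t ∈ Icc (2 * δ) (ε - 2 * δ), w t = 1 := fun t ht => w.one_of_mem_closedBall (by
    rw [Metric.mem_closedBall, Real.dist_eq, abs_le]
    show -(ε / 2 - 2 * δ) ≤ _ ∧ _ ≤ ε / 2 - 2 * δ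
    constructor <;> linarith [ht.1, ht.2])
  refine ⟨fun t => ∫ s in (0 : ℝ)..t, w s, ∫ s in (0 : ℝ)..(ε - δ), w s, ?_, ?_, ?_, ?_, ?_⟩
  · refine contDiff_infty_iff_deriv.2 ⟨fun t => (hderiv t).differentiableAt, ?_⟩
    rw [hd]
    exact w.contDiff
  · intro t
    rw [hd]
    exact ⟨w.nonneg, w.le_one⟩
  · intro t ht
    refine ⟨?_, by rw [hd]; exact hlow t ht⟩
    refine (intervalIntegral.integral_congr (g := fun _ => (0 : ℝ)) fun s hs => hlow s ?_).trans
      (by simp)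
    have := hs.2
    rw [max_def] at this
    split_ifs at this <;> linarith
  · intro t ht
    refine ⟨?_, by rw [hd]; exact hhigh t ht⟩
    have h0 : ∫ s in (ε - δ)..t, w s = 0 := by
      refine (intervalIntegral.integral_congr (g := fun _ => (0 : ℝ)) fun s hs => hhigh s ?_).trans
        (by simp)
      rw [uIcc_of_le ht] at hs
      exact hs.1
    have := intervalIntegral.integral_add_adjacent_intervals (hint 0 (ε - δ)) (hint (ε - δ) t)
    linarith
  · have h1 : ∫ s in (2 * δ)..(ε - 2 * δ), w s = ε - 4 * δ := by
      refine (intervalIntegral.integral_congr (g := fun _ => (1 : ℝ)) fun s hs => hmid s ?_).trans ?_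
      · rwa [uIcc_of_le (by linarith)] at hs
      · simp
        ring
    rw [← h1]
    exact intervalIntegral.integral_mono_interval (by linarith) (by linarith) (by linarith)
      (Eventually.of_forall fun s => w.nonneg) (hint _ _)

theorem iInf_integral_sq_nonneg {X : Type*} [MeasurableSpace X] (m : Measure X) (u : X → ℝ) :
    0 ≤ ⨅ c : ℝ, ∫ x, |u x - c| ^ 2 ∂m :=
  Real.iInf_nonneg fun _ => integral_nonneg fun _ => sq_nonneg _

namespace FinslerMetric

variable {n : ℕ} {M : Type*} [TopologicalSpace M] [ChartedSpace (EuclideanSpace ℝ (Fin n)) M]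
  [IsManifold (𝓡 n) ∞ M] (F : FinslerMetric n M)

/-- The condition `0 ≤ C` covers a trivial tangent space, where the supremum is over the empty set
and equals `0`. -/
theorem dual_le {x : M} {ξ : TangentSpace (𝓡 n) x →L[ℝ] ℝ} {C : ℝ} (hC : 0 ≤ C)
    (h : ∀ y, ξ y ≤ C * F.toFun x y) : F.dual x ξ ≤ C := by
  refine Real.sSup_le ?_ hC
  rintro _ ⟨y, -, rfl⟩
  exact div_le_of_le_mul₀ (F.nonneg x y) hC (h y)

theorem dual_nonneg (x : M) (ξ : TangentSpace (𝓡 n) x →L[ℝ] ℝ) : 0 ≤ F.dual x ξ := by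
  by_cases hne : ∃ y : TangentSpace (𝓡 n) x, y ≠ 0
  · obtain ⟨y, hy⟩ := hne
    refine Real.sSup_nonneg' ?_
    rcases le_total 0 (ξ y) with h | h
    · exact ⟨_, ⟨y, hy, rfl⟩, div_nonneg h (F.nonneg x y)⟩
    · refine ⟨_, ⟨-y, neg_ne_zero.2 hy, rfl⟩, div_nonneg ?_ (F.nonneg x _)⟩
      rw [map_neg]
      linarith
  · have : {a : ℝ | ∃ y : TangentSpace (𝓡 n) x, y ≠ 0 ∧ a = ξ y / F.toFun x y} = ∅ :=
      eq_empty_of_forall_notMem fun a ⟨y, hy, _⟩ => hne ⟨y, hy⟩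
    unfold dual
    rw [this, Real.sSup_empty]

section Eigenvalue

variable [MeasurableSpace M] (m : Measure M)

theorem energy_nonneg (u : M → ℝ) : 0 ≤ F.energy m u :=
  integral_nonneg fun _ => sq_nonneg _

theorem firstEigenvalue_nonneg : 0 ≤ F.firstEigenvalue m := by
  refine Real.sInf_nonneg ?_
  rintro _ ⟨u, -, -, rfl⟩
  exact div_nonneg (F.energy_nonneg m u) (iInf_integral_sq_nonneg m u)

/-- The Poincaré inequality with the first eigenvalue as constant. -/
theorem firstEigenvalue_mul_iInf_le {u : M → ℝ} (hu : ContMDiff (𝓡 n) 𝓘(ℝ, ℝ) ∞ u) :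
    F.firstEigenvalue m * ⨅ c : ℝ, ∫ x, |u x - c| ^ 2 ∂m ≤ F.energy m u := by
  by_cases h0 : (⨅ c : ℝ, ∫ x, |u x - c| ^ 2 ∂m) = 0
  · rw [h0, mul_zero]
    exact F.energy_nonneg m u
  · have hpos := (iInf_integral_sq_nonneg m u).lt_of_ne' h0
    rw [← le_div_iff₀ hpos]
    refine csInf_le ⟨0, ?_⟩ ⟨u, hu, h0, rfl⟩
    rintro _ ⟨v, -, -, rfl⟩
    exact div_nonneg (F.energy_nonneg m v) (iInf_integral_sq_nonneg m v)

variable [T2Space M] [CompactSpace M] [ConnectedSpace M] [BorelSpace M] [IsProbabilityMeasure m]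

/-- Two sets at distance at least `ε` cannot both have large measure. -/
theorem firstEigenvalue_mul_measure_le {A B : Set M} (hA : MeasurableSet A) (hB : MeasurableSet B)
    (hA0 : A.Nonempty) {ε : ℝ} (hε : 0 < ε) (hAB : ∀ a ∈ A, ∀ b ∈ B, ε ≤ F.dist a b) :
    F.firstEigenvalue m * ε ^ 2 * (m.real A * m.real B) ≤
      (m.real A + m.real B) * (1 - (m.real A + m.real B)) := by
  have hdisj : Disjoint A B := Set.disjoint_left.2 fun x hxA hxB => by
    have := hAB x hxA x hxB
    rw [F.dist_self] at this
    linarith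
  set a := m.real A with ha
  set b := m.real B with hb
  have ha0 : 0 ≤ a := measureReal_nonneg
  have hb0 : 0 ≤ b := measureReal_nonneg
  have hU : m.real (A ∪ B) = a + b := measureReal_union hdisj hB
  have hUc : m.real (A ∪ B)ᶜ = 1 - (a + b) := by
    rw [probReal_compl_eq_one_sub (hA.union hB), hU]
  set lam := F.firstEigenvalue m with hlam
  have hlam0 : 0 ≤ lam := F.firstEigenvalue_nonneg m
  have : Nonempty A := hA0.to_subtype
  have hbdd : ∀ x, BddBelow (range fun z : A => F.dist z x) := fun x =>
    ⟨0, by rintro _ ⟨z, rfl⟩; exact F.dist_nonneg _ _⟩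
  -- The distance is measured from `A`, so that the triangle inequality bounds `f z - f x` by `dist
  -- x z`, the orientation matching `F*(df) ≤ 1`.
  set f : M → ℝ := fun x => ⨅ z : A, F.dist z x with hf
  have hfA : ∀ x ∈ A, f x = 0 := fun x hx =>
    ((ciInf_le (hbdd x) ⟨x, hx⟩).trans_eq (F.dist_self x)).antisymm
      (Real.iInf_nonneg fun z => F.dist_nonneg _ _)
  have hfB : ∀ x ∈ B, ε ≤ f x := fun x hx => le_ciInf fun z => hAB z z.2 x hx
  have hfL : ∀ x z, f z - f x ≤ F.dist x z := by
    intro x z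
    have : f z - F.dist x z ≤ f x := le_ciInf fun y => by
      have h1 : f z ≤ F.dist y z := ciInf_le (hbdd z) y
      linarith [F.dist_triangle y x z]
    linarith
  -- The inequality with the losses of smoothing and cutoff; `δ → 0` at the end.
  have key : ∀ δ > 0, 4 * δ < ε →
      lam * (ε - 4 * δ) ^ 2 * (a * b) ≤ (a + b) * ((1 + δ) ^ 2 * (1 - (a + b))) := by
    intro δ hδ hδε
    obtain ⟨h, hh, hhf⟩ := F.exists_contMDiff_approx hfL hδ
    obtain ⟨Ψ, c₀, hΨ, hΨ', hΨlow, hΨhigh, hc₀⟩ := exists_smooth_clamp hδ hδε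
    have hhA : ∀ x ∈ A, h x ≤ δ := fun x hx => by
      have := (abs_le.1 (hhf x).1).2
      rw [hfA x hx] at this
      linarith
    have hhB : ∀ x ∈ B, ε - δ ≤ h x := fun x hx => by
      have := (abs_le.1 (hhf x).1).1
      linarith [hfB x hx]
    have hu : ContMDiff (𝓡 n) 𝓘(ℝ, ℝ) ∞ (Ψ ∘ h) := hΨ.contMDiff.comp hh
    have hdu : ∀ x (y : TangentSpace (𝓡 n) x),
        differential (Ψ ∘ h) x y = deriv Ψ (h x) * differential h x y := fun x y =>
      differential_comp (hΨ.differentiable (by simp) _) (hh.mdifferentiable (by simp) x) y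
    have henergy : F.energy m (Ψ ∘ h) ≤ (1 + δ) ^ 2 * (1 - (a + b)) := by
      have h1 : ∫ x, (A ∪ B)ᶜ.indicator (fun _ => (1 + δ) ^ 2) x ∂m =
          (1 + δ) ^ 2 * (1 - (a + b)) := by
        rw [integral_indicator_const _ (hA.union hB).compl, hUc, smul_eq_mul, mul_comm]
      rw [← h1]
      refine integral_mono_of_nonneg (Eventually.of_forall fun x => sq_nonneg _)
        ((integrable_const _).indicator (hA.union hB).compl) (Eventually.of_forall fun x => ?_)
      show F.dual x (differential (Ψ ∘ h) x) ^ 2 ≤ _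
      have hdn := F.dual_nonneg x (differential (Ψ ∘ h) x)
      by_cases hx : x ∈ A ∪ B
      · rw [indicator_of_notMem (not_not_intro hx)]
        -- The plateaus of `Ψ` start `δ` inside `[0, ε]`, absorbing the error `|h - f| ≤ δ`; thus
        -- the energy lives off `A ∪ B`.
        have hz : deriv Ψ (h x) = 0 := by
          rcases hx with hx | hx
          · exact (hΨlow _ (hhA x hx)).2
          · exact (hΨhigh _ (hhB x hx)).2
        have : F.dual x (differential (Ψ ∘ h) x) ≤ 0 :=
          F.dual_le le_rfl fun y => by rw [hdu, hz, zero_mul, zero_mul]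
        rw [le_antisymm this hdn]
        simp
      · rw [indicator_of_mem hx]
        refine pow_le_pow_left₀ hdn (F.dual_le (by linarith) fun y => ?_) 2
        rw [hdu]
        have hF := F.nonneg x y
        -- The bound on `dh` is one-sided, so `Ψ' ≥ 0` is needed to keep its direction.
        have h2 := mul_le_mul_of_nonneg_left ((hhf x).2 y) (hΨ' (h x)).1
        have h3 := mul_le_mul_of_nonneg_right (hΨ' (h x)).2
          (show 0 ≤ (1 + δ) * F.toFun x y by positivity)
        linarith
    have hvar : a * b * c₀ ^ 2 ≤ (a + b) * ⨅ c : ℝ, ∫ x, |(Ψ ∘ h) x - c| ^ 2 ∂m := by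
      rw [Real.mul_iInf_of_nonneg (by linarith)]
      refine le_ciInf fun c => ?_
      have hint : Integrable (fun x => |(Ψ ∘ h) x - c| ^ 2) m :=
        ((hu.continuous.sub continuous_const).abs.pow 2).integrable_of_hasCompactSupport
          (HasCompactSupport.of_compactSpace _)
      have h1 : ∫ x, (A.indicator (fun _ => c ^ 2) x + B.indicator (fun _ => (c₀ - c) ^ 2) x) ∂m =
          a * c ^ 2 + b * (c₀ - c) ^ 2 := by
        rw [integral_add ((integrable_const _).indicator hA) ((integrable_const _).indicator hB),
          integral_indicator_const _ hA, integral_indicator_const _ hB, smul_eq_mul, smul_eq_mul]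
      have h2 : a * c ^ 2 + b * (c₀ - c) ^ 2 ≤ ∫ x, |(Ψ ∘ h) x - c| ^ 2 ∂m := by
        rw [← h1]
        refine integral_mono (((integrable_const _).indicator hA).add
          ((integrable_const _).indicator hB)) hint fun x => ?_
        show A.indicator (fun _ => c ^ 2) x + B.indicator (fun _ => (c₀ - c) ^ 2) x ≤ _
        by_cases hxA : x ∈ A
        · rw [indicator_of_mem hxA, indicator_of_notMem (Set.disjoint_left.1 hdisj hxA)]
          simp [(hΨlow _ (hhA x hxA)).1]
        · rw [indicator_of_notMem hxA]
          by_cases hxB : x ∈ B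
          · rw [indicator_of_mem hxB]
            simp [(hΨhigh _ (hhB x hxB)).1]
          · rw [indicator_of_notMem hxB]
            simp only [add_zero]
            positivity
      have h3 := mul_le_mul_of_nonneg_left h2 (show 0 ≤ a + b by linarith)
      -- The identity is `(a + b)(a c² + b (c₀ - c)²) = a b c₀² + (a c - b (c₀ - c))²`.
      nlinarith [sq_nonneg (a * c - b * (c₀ - c))]
    have h5 := F.firstEigenvalue_mul_iInf_le m hu
    have hsq : (ε - 4 * δ) ^ 2 ≤ c₀ ^ 2 := pow_le_pow_left₀ (by linarith) hc₀ 2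
    calc lam * (ε - 4 * δ) ^ 2 * (a * b) ≤ lam * (a * b * c₀ ^ 2) := by
          rw [mul_assoc, mul_comm (a * b)]
          exact mul_le_mul_of_nonneg_left
            (mul_le_mul_of_nonneg_right hsq (mul_nonneg ha0 hb0)) hlam0
      _ ≤ lam * ((a + b) * ⨅ c : ℝ, ∫ x, |(Ψ ∘ h) x - c| ^ 2 ∂m) :=
          mul_le_mul_of_nonneg_left hvar hlam0
      _ = (a + b) * (lam * ⨅ c : ℝ, ∫ x, |(Ψ ∘ h) x - c| ^ 2 ∂m) := by ring
      _ ≤ (a + b) * ((1 + δ) ^ 2 * (1 - (a + b))) :=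
          mul_le_mul_of_nonneg_left (h5.trans henergy) (by linarith)
  have hlim1 : Tendsto (fun δ : ℝ => lam * (ε - 4 * δ) ^ 2 * (a * b)) (𝓝[>] 0)
      (𝓝 (lam * (ε - 4 * 0) ^ 2 * (a * b))) :=
    (Continuous.tendsto (by fun_prop) 0).mono_left nhdsWithin_le_nhds
  have hlim2 : Tendsto (fun δ : ℝ => (a + b) * ((1 + δ) ^ 2 * (1 - (a + b)))) (𝓝[>] 0)
      (𝓝 ((a + b) * ((1 + 0) ^ 2 * (1 - (a + b))))) :=
    (Continuous.tendsto (by fun_prop) 0).mono_left nhdsWithin_le_nhds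
  have := le_of_tendsto_of_tendsto hlim1 hlim2 (by
    filter_upwards [self_mem_nhdsWithin,
      nhdsWithin_le_nhds (gt_mem_nhds (show (0 : ℝ) < ε / 4 by linarith))] with δ h1 h2
    exact key δ h1 (by linarith))
  simpa using this

end Eigenvalue

end FinslerMetric

/-! ### Iterated halving and concentration -/

/-- If passing to the forward `ε`-neighbourhood halves the measure of the complement of every set of
measure at least `1/2`, then these complements decay geometrically. -/
theorem one_sub_measureReal_forwardNhd_le {X : Type*} [MeasurableSpace X] {μ : Measure X}
    [IsProbabilityMeasure μ] {d : X → X → ℝ} (hself : ∀ x, d x x = 0)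
    (htri : ∀ x y z, d x z ≤ d x y + d y z) {ε : ℝ} (hε : 0 < ε)
    (hmeas : ∀ A, MeasurableSet (forwardNhd d A ε))
    (hhalf : ∀ A, MeasurableSet A → 1 / 2 ≤ μ.real A →
      1 - μ.real (forwardNhd d A ε) ≤ (1 - μ.real A) / 2)
    {A : Set X} (hA : MeasurableSet A) (hA2 : 1 / 2 ≤ μ.real A) {r : ℝ} (hr : 0 < r) :
    1 - μ.real (forwardNhd d A r) ≤ Real.exp (-(r / ε * Real.log 2)) := by
  -- The exponent is `k + 1` because the complement of `A` already has measure at most `1/2`; this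
  -- is why the final bound has prefactor `1`.
  have key : ∀ k : ℕ, ∃ A' : Set X, MeasurableSet A' ∧ 1 - μ.real A' ≤ (1 / 2) ^ (k + 1) ∧
      ∀ x ∈ A', ∃ z ∈ A, d z x ≤ k * ε := by
    intro k
    induction k with
    | zero => exact ⟨A, hA, by norm_num; linarith, fun x hx => ⟨x, hx, by simp [hself]⟩⟩
    | succ k ih =>
      obtain ⟨A', hA', hv, hd⟩ := ih
      refine ⟨forwardNhd d A' ε, hmeas A', ?_, ?_⟩
      · have h1 : (1 / 2 : ℝ) ^ (k + 1) ≤ (1 / 2) ^ 1 :=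
          pow_le_pow_of_le_one (by norm_num) (by norm_num) (by omega)
        have h2 := hhalf A' hA' (by linarith)
        rw [pow_succ]
        linarith
      · rintro x ⟨y, hy, hyx⟩
        obtain ⟨z, hz, hzy⟩ := hd y hy
        refine ⟨z, hz, ?_⟩
        push_cast
        linarith [htri z y x]
  -- With `k + 1 = ⌈r / ε⌉`, one has `k ε < r ≤ (k + 1) ε`: `k` enlargements stay within distance
  -- `r`, and `k + 1` halvings are counted.
  obtain ⟨k, hk⟩ := Nat.exists_eq_succ_of_ne_zero (Nat.ceil_pos.2 (div_pos hr hε)).ne'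
  have hk1 : (k : ℝ) * ε < r := by
    rw [← lt_div_iff₀ hε]
    exact Nat.lt_ceil.1 (by omega)
  have hk2 : r / ε ≤ (k + 1 : ℕ) := (Nat.le_ceil _).trans_eq (by rw [hk])
  obtain ⟨A', hA', hv, hd⟩ := key k
  have hsub : A' ⊆ forwardNhd d A r := fun x hx => by
    obtain ⟨z, hz, hzx⟩ := hd x hx
    exact ⟨z, hz, hzx.trans_lt hk1⟩
  have hmono := measureReal_mono (μ := μ) hsub
  have hexp : (1 / 2 : ℝ) ^ (k + 1) = Real.exp (-((k + 1 : ℕ) * Real.log 2)) := by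
    rw [Real.exp_neg, mul_comm, ← Real.rpow_def_of_pos two_pos, Real.rpow_natCast, one_div, inv_pow]
  calc 1 - μ.real (forwardNhd d A r) ≤ 1 - μ.real A' := by linarith
    _ ≤ (1 / 2) ^ (k + 1) := hv
    _ = Real.exp (-((k + 1 : ℕ) * Real.log 2)) := hexp
    _ ≤ _ := Real.exp_le_exp.2
      (neg_le_neg (mul_le_mul_of_nonneg_right hk2 (Real.log_nonneg one_le_two)))

namespace FinslerMetric

variable {n : ℕ} {M : Type*} [TopologicalSpace M] [ChartedSpace (EuclideanSpace ℝ (Fin n)) M]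
  [IsManifold (𝓡 n) ∞ M] [CompactSpace M] [ConnectedSpace M] [MeasurableSpace M]
  (F : FinslerMetric n M) (m : Measure M) [IsProbabilityMeasure m]

/-- Beyond a bound `D` for the distance, neighbourhoods of nonempty sets are everything; for `r ≤ D`
the trivial bound `1 ≤ exp (D - r)` suffices. -/
theorem hasExponentialConcentration : HasExponentialConcentration F.dist m := by
  obtain ⟨D, hD⟩ := F.exists_dist_lt
  refine ⟨Real.exp D, 1, Real.exp_pos D, one_pos, fun r _ => ?_⟩
  rw [one_mul, ← Real.exp_add]
  refine Real.sSup_le ?_ (Real.exp_pos _).le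
  rintro _ ⟨A, -, hA2, rfl⟩
  obtain ⟨a, ha⟩ : A.Nonempty := nonempty_of_measureReal_ne_zero (μ := m) (by linarith)
  rcases le_total D r with h | h
  · have h1 : forwardNhd F.dist A r = univ :=
      eq_univ_of_forall fun x => ⟨a, ha, (hD a x).trans_le h⟩
    have h2 : backwardNhd F.dist A r = univ :=
      eq_univ_of_forall fun x => ⟨a, ha, (hD x a).trans_le h⟩
    rw [h1, h2, min_self, probReal_univ, sub_self]
    exact (Real.exp_pos _).le
  · have h1 : 0 ≤ min (m.real (forwardNhd F.dist A r)) (m.real (backwardNhd F.dist A r)) :=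
      le_min measureReal_nonneg measureReal_nonneg
    have h2 : 1 ≤ Real.exp (D + -r) := Real.one_le_exp (by linarith)
    linarith

variable [T2Space M] [BorelSpace M]

/-- With `b` the measure of the complement of the neighbourhood and `s = 1 - a ≤ a`, the inequality
`2ab ≤ (a + b)(s - b)` reads `b (3a - s + b) ≤ a s`. Since `3a - s ≥ 2a`, this gives `b ≤ s / 2`. -/
theorem one_sub_measureReal_forwardNhd_le_half {ε : ℝ} (hε : 0 < ε)
    (hlam : F.firstEigenvalue m * ε ^ 2 = 2) {A : Set M} (hA : MeasurableSet A)
    (hA2 : 1 / 2 ≤ m.real A) :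
    1 - m.real (forwardNhd F.dist A ε) ≤ (1 - m.real A) / 2 := by
  have hA0 : A.Nonempty := nonempty_of_measureReal_ne_zero (μ := m) (by linarith)
  have hmeas := (F.isOpen_forwardNhd A ε).measurableSet
  have h := F.firstEigenvalue_mul_measure_le m hA hmeas.compl hA0 hε
    fun a ha b hb => not_lt.1 fun hlt => hb ⟨a, ha, hlt⟩
  rw [hlam, probReal_compl_eq_one_sub hmeas] at h
  have h1 : m.real (forwardNhd F.dist A ε) ≤ 1 := measureReal_le_one
  have h2 : m.real A ≤ m.real (forwardNhd F.dist A ε) :=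
    measureReal_mono fun x hx => ⟨x, hx, by rwa [F.dist_self]⟩
  nlinarith

/-- The separated-set inequality is applied from the complement of the neighbourhood to `A`. It
needs a nonempty source, hence the separate case of an empty complement. -/
theorem one_sub_measureReal_backwardNhd_le_half {ε : ℝ} (hε : 0 < ε)
    (hlam : F.firstEigenvalue m * ε ^ 2 = 2) {A : Set M} (hA : MeasurableSet A)
    (hA2 : 1 / 2 ≤ m.real A) :
    1 - m.real (backwardNhd F.dist A ε) ≤ (1 - m.real A) / 2 := by
  have hmeas := (F.isOpen_backwardNhd A ε).measurableSet
  have h1 : m.real (backwardNhd F.dist A ε) ≤ 1 := measureReal_le_one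
  have h2 : m.real A ≤ m.real (backwardNhd F.dist A ε) :=
    measureReal_mono fun x hx => ⟨x, hx, by rwa [F.dist_self]⟩
  rcases (backwardNhd F.dist A ε)ᶜ.eq_empty_or_nonempty with hB | hB
  · rw [compl_empty_iff.1 hB, probReal_univ]
    linarith [measureReal_le_one (μ := m) (s := A)]
  · have h := F.firstEigenvalue_mul_measure_le m hmeas.compl hA hB hε
      fun b hb a ha => not_lt.1 fun hlt => hb ⟨a, ha, hlt⟩
    rw [hlam, probReal_compl_eq_one_sub hmeas] at h
    nlinarith

theorem concentrationFunction_le_exp {r : ℝ} (hr : 0 < r) :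
    concentrationFunction F.dist m r ≤
      Real.exp (-(r * √(F.firstEigenvalue m) * (Real.log 2 / √2))) := by
  refine Real.sSup_le ?_ (Real.exp_pos _).le
  rintro _ ⟨A, hA, hA2, rfl⟩
  -- If the eigenvalue is `0`, the claimed bound is `exp 0 = 1`.
  rcases (F.firstEigenvalue_nonneg m).eq_or_lt with h0 | hpos
  · rw [← h0]
    have : 0 ≤ min (m.real (forwardNhd F.dist A r)) (m.real (backwardNhd F.dist A r)) :=
      le_min measureReal_nonneg measureReal_nonneg
    simp [this]
  · set ε := √2 / √(F.firstEigenvalue m) with hε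
    have hs : 0 < √(F.firstEigenvalue m) := Real.sqrt_pos.2 hpos
    have hε0 : 0 < ε := div_pos (Real.sqrt_pos.2 two_pos) hs
    have hlam : F.firstEigenvalue m * ε ^ 2 = 2 := by
      rw [hε, div_pow, Real.sq_sqrt hpos.le, Real.sq_sqrt zero_le_two]
      field_simp
    have hexp : r * √(F.firstEigenvalue m) * (Real.log 2 / √2) = r / ε * Real.log 2 := by
      rw [hε]
      field_simp
    rw [hexp]
    have h1 := one_sub_measureReal_forwardNhd_le (μ := m) F.dist_self F.dist_triangle hε0
      (fun A => (F.isOpen_forwardNhd A ε).measurableSet)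
      (fun A hA hA2 => F.one_sub_measureReal_forwardNhd_le_half m hε0 hlam hA hA2) hA hA2 hr
    -- A backward neighbourhood is a forward neighbourhood for the reversed distance.
    have h2 := one_sub_measureReal_forwardNhd_le (μ := m) (d := fun x z => F.dist z x) F.dist_self
      (fun x y z => (F.dist_triangle z y x).trans_eq (add_comm _ _)) hε0
      (fun A => (F.isOpen_backwardNhd A ε).measurableSet)
      (fun A hA hA2 => F.one_sub_measureReal_backwardNhd_le_half m hε0 hlam hA hA2) hA hA2 hr
    rcases min_choice (m.real (forwardNhd F.dist A r)) (m.real (backwardNhd F.dist A r)) with h | h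
    · rw [h]
      exact h1
    · rw [h]
      exact h2

end FinslerMetric

theorem theorem6p1 {n : ℕ} {M : Type*} [TopologicalSpace M] [T2Space M] [CompactSpace M]
    [ConnectedSpace M] [ChartedSpace (EuclideanSpace ℝ (Fin n)) M] [IsManifold (𝓡 n) ∞ M]
    [MeasurableSpace M] [BorelSpace M]
    (F : FinslerMetric n M) (m : Measure M) (hm : IsPositiveSmoothMeasure n m)
    (hm1 : m univ = 1) :
    (∀ r : ℝ, 0 < r →
      concentrationFunction F.dist m r ≤
        Real.exp (-(r * √(F.firstEigenvalue m) * (Real.log 2 / √2)))) ∧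
    HasExponentialConcentration F.dist m := by
  have : IsProbabilityMeasure m := ⟨hm1⟩
  exact ⟨fun r hr => F.concentrationFunction_le_exp m hr, F.hasExponentialConcentration m⟩
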